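/- Let $c\ge 1$ be an integer and let $(b_j)_{j\ge 0}$ be real numbers with $b_j\ge 0$ for $j\ne 1$, $0<-b_1=\sum_{j\neq 1}b_j<\infty$, $b_0>0$ and $\sum_{j\ge 2}b_j>0$. The stopped $M^X/M/c$ queue is the continuous-time Markov chain $(X^*_t)_{t\ge 0}$ on $\{0,1,2,\dots\}$ with right-continuous paths and conservative bounded $q$-matrix $Q^*$ given, for $i\ge 1$, by $$q^*_{i,i-1}=\min(i,c)\,b_0,\qquad q^*_{ii}=b_1-[\min(i,c)-1]\,b_0,\qquad q^*_{ij}=b_{j-i+1}\ (j\ge i+1),$$ all other entries (in particular the whole row $i=0$) being $0$. Let $p^*_{ij}(t)$ be its transition function, $\tau^*_0=\inf\{t>0: X^*_t=0\}$ (with $\inf\emptyset=\infty$), $e^*_k=P(\tau^*_0<\infty\mid X^*_0=k)$ and $m^*_i(k)=\int_0^\infty p^*_{ki}(t)\,dt$. Put $B(s)=\sum_{j\ge0}b_js^j$ and $B_c(s)=B(s)+(c-1)b_0(1-s)$ for $s\in[0,1]$, and let $B_c'(1)=\sum_{j\ge 1}jb_j-(c-1)b_0\in(-\infty,\infty]$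 be its left derivative at $1$. **Theorem.** Let $k\ge 1$. Then $e^*_k=\lim_{t\to\infty}p^*_{k0}(t)$, and $m^*_i(k)<\infty$ for all $i\ge 1$. Moreover: (i) If $B_c'(1)\le 0$, then $e^*_k=1$. (ii) The equation $B_c(s)=0$ has a smallest root $u$ in $[0,1]$; $u=1$ if $B_c'(1)\le 0$ and $u<1$ if $B_c'(1)>0$. Whatever the sign of $B_c'(1)$ (in particular if $B_c'(1)>0$), $e=e^*_k$ and $m_i=m^*_i(k)$ $(1\le i\le c-1)$ form the unique real solution $(e,m_1,\dots,m_{c-1})$ of the linear system consisting of $$e=u^k-\sum_{i=1}^{c-1}m_i\,u^{i-1}(c-i)\,b_0(1-u),$$ of $b_0m_1=e$ (if $c\ge 2$), and, for $1\le j\le c-2$, of $$\sum_{i=1}^{j-1}b_{j-i+1}m_i+[b_1-(j-1)b_0]\,m_j+(j+1)b_0\,m_{j+1}=-\delta_{kj}.$$ Moreover, all the $m^*_i(k)$, $i\ge1$, are determined by $e^*_k$: they form the unique real sequence $(m_i)_{i\ge1}$ with $b_0m_1=e^*_k$ and, for every $j\ge 1$, $$\sum_{i=1}^{j-1}b_{j-i+1}m_i+[b_1-(\min(j,c)-1)b_0]\,m_j+\min(j+1,c)\,b_0\,m_{j+1}=-\delta_{kj}.$$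 (iii) The mean extinction time is $$E(\tau^*_0\mid X^*_0=k)=\begin{cases}-\dfrac{1}{B_c'(1)}\Big[k+\displaystyle\sum_{i=1}^{c-1}m^*_i(k)(c-i)b_0\Big] & \text{if } B_c'(1)<0,\\[2mm] \infty & \text{if } B_c'(1)\ge 0.\end{cases}$$ -/

import Mathlib

open Set Filter Topology MeasureTheory ProbabilityTheory
open scoped NNReal ENNReal

noncomputable section

namespace StoppedQueue

/-- The parameters `(b_j)` of the queue: `b_j ≥ 0` for `j ≠ 1`, `∑_{j ≠ 1} b_j = -b_1 < ∞`, and the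
nontriviality conditions `b_0 > 0` and `∑_{j ≥ 2} b_j > 0` (so that `-b_1 > 0`). -/
structure IsRateSequence (b : ℕ → ℝ) : Prop where
  nonneg : ∀ j, j ≠ 1 → 0 ≤ b j
  hasSum : HasSum (fun j => if j = 1 then 0 else b j) (-b 1)
  zero_pos : 0 < b 0
  tail_pos : 0 < ∑' j, b (j + 2)

/-- The `q`-matrix `Q*` of the stopped `M^X/M/c` queue. -/
def qStar (b : ℕ → ℝ) (c i j : ℕ) : ℝ :=
  if 1 ≤ i ∧ j + 1 = i then ((min i c : ℕ) : ℝ) * b 0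
  else if 1 ≤ i ∧ j = i then b 1 - (((min i c : ℕ) : ℝ) - 1) * b 0
  else if 1 ≤ i ∧ i + 1 ≤ j then b (j - i + 1)
  else 0

/-- The generating function `B(s) = ∑ b_j s^j`. -/
def genB (b : ℕ → ℝ) (s : ℝ) : ℝ := ∑' j, b j * s ^ j

/-- `B_i(s) = B(s) + (i - 1) b_0 (1 - s)`. -/
def genBi (b : ℕ → ℝ) (i : ℕ) (s : ℝ) : ℝ := genB b s + ((i : ℝ) - 1) * b 0 * (1 - s)

/-- `B_i'(1) = ∑ j b_j - (i - 1) b_0 ∈ (-∞, ∞]`, the (left) derivative of the power series `B_i`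
at its boundary point `1`; it equals `+∞` when `∑ j b_j` diverges. See `tendsto_slope_genBi`. -/
def genBiDerivOne (b : ℕ → ℝ) (i : ℕ) : EReal :=
  ((∑' j : ℕ, ENNReal.ofReal (if j = 1 then 0 else (j : ℝ) * b j) : ℝ≥0∞) : EReal)
    + ((b 1 - ((i : ℝ) - 1) * b 0 : ℝ) : EReal)

/-- Standard (possibly substochastic) transition functions on `ℕ`. -/
structure IsTransitionFunction (p : ℝ → ℕ → ℕ → ℝ) : Prop where
  nonneg : ∀ t, 0 ≤ t → ∀ i j, 0 ≤ p t i j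
  summable : ∀ t, 0 ≤ t → ∀ i, Summable (p t i)
  sum_le_one : ∀ t, 0 ≤ t → ∀ i, ∑' j, p t i j ≤ 1
  zero : ∀ i j, p 0 i j = if i = j then 1 else 0
  chapman_kolmogorov : ∀ s t, 0 ≤ s → 0 ≤ t → ∀ i j,
    HasSum (fun l => p s i l * p t l j) (p (s + t) i j)
  standard : ∀ i j, Tendsto (fun t => p t i j) (𝓝[>] 0) (𝓝 (if i = j then 1 else 0))

/-- `p` is a `Q`-function: a standard transition function with `p'(0) = Q` (right derivative at
`0`, entry by entry). -/
structure IsQFunction (q : ℕ → ℕ → ℝ) (p : ℝ → ℕ → ℕ → ℝ) : Prop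
    extends IsTransitionFunction p where
  deriv_zero : ∀ i j, HasDerivWithinAt (fun t => p t i j) (q i j) (Ici 0) 0

/-- `X` is a continuous-time Markov chain on `ℕ` under the probability `P`, with transition function
`p`, an arbitrary initial law, and almost surely right-continuous paths (`ℕ` being discrete). -/
structure IsMarkovChain {Ω : Type*} [MeasurableSpace Ω] (p : ℝ → ℕ → ℕ → ℝ)
    (X : ℝ≥0 → Ω → ℕ) (P : Measure Ω) : Prop where
  measurable : ∀ t, Measurable (X t)
  rightCts : ∀ᵐ ω ∂P, ∀ t, ContinuousWithinAt (fun r => X r ω) (Ici t) t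
  law : ∀ (n : ℕ) (t : ℕ → ℝ≥0), Monotone t → t 0 = 0 → ∀ x : ℕ → ℕ,
    P {ω | ∀ l ≤ n, X (t l) ω = x l} =
      P {ω | X 0 ω = x 0} *
        ∏ l ∈ Finset.range n,
          ENNReal.ofReal (p ((t (l + 1) : ℝ) - (t l : ℝ)) (x l) (x (l + 1)))

/-- The extinction time `inf {t > 0 | X_t = 0}`, equal to `∞` if there is no such `t`. -/
def extinctionTime {Ω : Type*} (X : ℝ≥0 → Ω → ℕ) (ω : Ω) : ℝ≥0∞ :=
  ⨅ (t : ℝ≥0) (_ : 0 < t ∧ X t ω = 0), (t : ℝ≥0∞)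

/-- `e*_k = P(τ < ∞ | X_0 = k)`. -/
def extinctionProb {Ω : Type*} [MeasurableSpace Ω] (X : ℝ≥0 → Ω → ℕ) (P : Measure Ω) (k : ℕ) : ℝ :=
  (P[|{ω | X 0 ω = k}] {ω | extinctionTime X ω < ∞}).toReal

/-- `E(τ | X_0 = k) ∈ [0, ∞]`. -/
def meanExtinctionTime {Ω : Type*} [MeasurableSpace Ω] (X : ℝ≥0 → Ω → ℕ) (P : Measure Ω)
    (k : ℕ) : ℝ≥0∞ :=
  ∫⁻ ω, extinctionTime X ω ∂(P[|{ω | X 0 ω = k}])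

/-- The expected occupation time `m*_i(k) = ∫_0^∞ p_{ki}(t) dt`. -/
def occupationTime (p : ℝ → ℕ → ℕ → ℝ) (k i : ℕ) : ℝ := ∫ t in Ioi (0 : ℝ), p t k i

/-- The linear system for the `c` unknowns `e` and `m 1, …, m (c - 1)`: one equation if `c = 1`, and
`c` equations in general. No other value of `m` occurs in it. -/
structure ExtinctionSystem (b : ℕ → ℝ) (c k : ℕ) (u e : ℝ) (m : ℕ → ℝ) : Prop where
  root : e = u ^ k -
    ∑ i ∈ Finset.Icc 1 (c - 1), m i * u ^ (i - 1) * ((c : ℝ) - (i : ℝ)) * b 0 * (1 - u)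
  absorb : 2 ≤ c → b 0 * m 1 = e
  balance : ∀ j, 1 ≤ j → j + 2 ≤ c →
    ∑ i ∈ Finset.Icc 1 (j - 1), b (j - i + 1) * m i + (b 1 - ((j : ℝ) - 1) * b 0) * m j
      + ((j : ℝ) + 1) * b 0 * m (j + 1) = -(if k = j then 1 else 0)

/-- The recursion that continues the system to all `m i`, `i ≥ 1`: it is
`∑_{i ≥ 1} m_i q*_{ij} = -δ_{kj}` for every `j ≥ 1`, together with `b_0 m_1 = e`. -/
structure OccupationRecursion (b : ℕ → ℝ) (c k : ℕ) (e : ℝ) (m : ℕ → ℝ) : Prop where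
  absorb : b 0 * m 1 = e
  balance : ∀ j, 1 ≤ j →
    ∑ i ∈ Finset.Icc 1 (j - 1), b (j - i + 1) * m i
      + (b 1 - (((min j c : ℕ) : ℝ) - 1) * b 0) * m j
      + ((min (j + 1) c : ℕ) : ℝ) * b 0 * m (j + 1) = -(if k = j then 1 else 0)

/-- `genBiDerivOne b i` is the left derivative at `1` of the function `B_i` (in `(-∞, ∞]`). -/
theorem tendsto_slope_genBi {b : ℕ → ℝ} (hb : IsRateSequence b) (i : ℕ) :
    Tendsto (fun s : ℝ => ((slope (genBi b i) 1 s : ℝ) : EReal)) (𝓝[<] 1)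
      (𝓝 (genBiDerivOne b i)) := by
  set a : ℕ → ℝ := fun j => if j = 1 then 0 else b j with ha
  have ha0 : ∀ j, 0 ≤ a j := by
    intro j
    by_cases h : j = 1
    · simp [ha, h]
    · simpa [ha, h] using hb.nonneg j h
  have hS : Summable a := hb.hasSum.summable
  -- the finite geometric sums
  let g : ℕ → ℝ → ℝ := fun j s => a j * ∑ l ∈ Finset.range j, s ^ l
  have hg0 : ∀ j s, 0 ≤ s → 0 ≤ g j s := fun j s hs =>
    mul_nonneg (ha0 j) (Finset.sum_nonneg fun l _ => pow_nonneg hs l)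
  have hg1 : ∀ j, g j 1 = if j = 1 then 0 else (j : ℝ) * b j := by
    intro j
    by_cases h : j = 1 <;> simp [g, ha, h, mul_comm]
  have hgle : ∀ j s, 0 ≤ s → s ≤ 1 → g j s ≤ g j 1 := by
    intro j s hs hs1
    refine mul_le_mul_of_nonneg_left (Finset.sum_le_sum fun l _ => ?_) (ha0 j)
    simpa using pow_le_one₀ hs hs1
  have hev : ∀ᶠ s : ℝ in 𝓝[<] 1, s ∈ Ioo (0 : ℝ) 1 := Ioo_mem_nhdsLT one_pos
  have hT : Tendsto (fun s : ℝ => ∑' j, ENNReal.ofReal (g j s)) (𝓝[<] 1)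
      (𝓝 (∑' j, ENNReal.ofReal (g j 1))) := by
    refine tendsto_order.2 ⟨fun x hx => ?_, fun x hx => ?_⟩
    · rw [ENNReal.tsum_eq_iSup_sum, lt_iSup_iff] at hx
      obtain ⟨F, hF⟩ := hx
      have hc : Continuous (fun s : ℝ => ∑ j ∈ F, ENNReal.ofReal (g j s)) := by
        refine continuous_finsetSum _ fun j _ => ENNReal.continuous_ofReal.comp ?_
        fun_prop
      have := (hc.tendsto 1).mono_left (nhdsWithin_le_nhds (s := Iio 1))
      filter_upwards [(tendsto_order.1 this).1 x hF] with s hs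
      exact hs.trans_le (ENNReal.sum_le_tsum F)
    · filter_upwards [hev] with s hs
      exact lt_of_le_of_lt (ENNReal.tsum_le_tsum fun j =>
        ENNReal.ofReal_le_ofReal (hgle j s hs.1.le hs.2.le)) hx
  have hT' := ((continuous_coe_ennreal_ereal.tendsto _).comp hT)
  have hadd : Tendsto (fun s : ℝ => ((∑' j, ENNReal.ofReal (g j s) : ℝ≥0∞) : EReal)
      + ((b 1 - ((i : ℝ) - 1) * b 0 : ℝ) : EReal)) (𝓝[<] 1) (𝓝 (genBiDerivOne b i)) := by
    have hcont := EReal.continuousAt_add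
      (p := (((∑' j, ENNReal.ofReal (g j 1) : ℝ≥0∞) : EReal),
        ((b 1 - ((i : ℝ) - 1) * b 0 : ℝ) : EReal)))
      (Or.inr (EReal.coe_ne_bot _)) (Or.inr (EReal.coe_ne_top _))
    have h2 := hcont.tendsto.comp (hT'.prodMk_nhds
      (tendsto_const_nhds (x := ((b 1 - ((i : ℝ) - 1) * b 0 : ℝ) : EReal))))
    have e1 : genBiDerivOne b i = ((∑' j, ENNReal.ofReal (g j 1) : ℝ≥0∞) : EReal)
        + ((b 1 - ((i : ℝ) - 1) * b 0 : ℝ) : EReal) := by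
      simp only [genBiDerivOne, hg1]
    rw [e1]
    exact h2
  refine hadd.congr' ?_
  filter_upwards [hev] with s hs
  have hne : s - 1 ≠ 0 := by linarith [hs.2]
  have hgeo : ∀ j, a j * s ^ j - a j = (s - 1) * g j s := by
    intro j
    have := geom_sum_mul s j
    simp only [g]
    linear_combination (-a j) * this
  have hSs : Summable (fun j => a j * s ^ j) :=
    Summable.of_nonneg_of_le (fun j => mul_nonneg (ha0 j) (pow_nonneg hs.1.le j))
      (fun j => mul_le_of_le_one_right (ha0 j) (pow_le_one₀ hs.1.le hs.2.le)) hS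
  have hgS : Summable (fun j => g j s) := by
    have := (hSs.sub hS).mul_left (s - 1)⁻¹
    refine this.congr fun j => ?_
    rw [hgeo j]
    field_simp
  have hsplit : ∀ r : ℝ, Summable (fun j => a j * r ^ j) →
      genB b r = ∑' j, a j * r ^ j + b 1 * r := by
    intro r hr
    have h1 : HasSum (fun j => if j = 1 then b 1 * r else 0) (b 1 * r) := hasSum_ite_eq 1 _
    refine (HasSum.congr_fun (hr.hasSum.add h1) fun j => ?_).tsum_eq
    by_cases h : j = 1 <;> simp [ha, h]
  have hd : ∑' j, a j * s ^ j - ∑' j, a j = (s - 1) * ∑' j, g j s := by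
    rw [← hSs.tsum_sub hS, ← tsum_mul_left]
    exact tsum_congr hgeo
  have hslope : slope (genBi b i) 1 s = ∑' j, g j s + (b 1 - ((i : ℝ) - 1) * b 0) := by
    rw [slope_def_field, div_eq_iff hne]
    simp only [genBi]
    rw [hsplit s hSs, hsplit 1 (by simpa using hS)]
    simp only [one_pow, mul_one]
    linear_combination hd
  rw [hslope, ← ENNReal.ofReal_tsum_of_nonneg (fun j => hg0 j s hs.1.le) hgS,
    EReal.coe_ennreal_ofReal, max_eq_left (tsum_nonneg fun j => hg0 j s hs.1.le), EReal.coe_add]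

end StoppedQueue

/-!
Integrating Kolmogorov's forward equation shows that the occupation times `m_i` satisfy
`m Q* = -δ_k + e δ_0` with `e = b_0 m_1` the absorption probability. In terms of generating
functions this reads
`B_c(s) ∑ m_i s^(i-1) = e - s^k + (1 - s) b_0 ∑_{i<c} (c - i) m_i s^(i-1)` for `0 ≤ s < 1`.
The right-hand side vanishes at a root `u < 1` of `B_c`, which is the first equation of the linear
system; when there is no such root, `B_c > 0` on `[0, 1)` and letting `s → 1` gives `e = 1`.
Dividing by `1 - s` before letting `s → 1` computes `∑ m_i`, which is the mean extinction time.
The flow across each level determines `m` from `e`, monotonically, whereas the root equation makes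
`e` decrease when `m` increases; hence the linear system has only one solution.
-/

noncomputable section

namespace StoppedQueue

/-! ### Transition functions with bounded `q`-matrix -/

/-- The expected occupation time `∫_0^t p_{ki}(r) dr` of the state `i` before time `t`, started from
`k`. -/
def occupationTimeUpTo (p : ℝ → ℕ → ℕ → ℝ) (k i : ℕ) (t : ℝ) : ℝ := ∫ r in (0 : ℝ)..t, p r k i

namespace IsTransitionFunction

variable {p : ℝ → ℕ → ℕ → ℝ} {s t : ℝ}

theorem sum_finset_le_one (hp : IsTransitionFunction p) (ht : 0 ≤ t) (i : ℕ) (F : Finset ℕ) :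
    ∑ j ∈ F, p t i j ≤ 1 :=
  ((hp.summable t ht i).sum_le_tsum F fun j _ => hp.nonneg t ht i j).trans (hp.sum_le_one t ht i)

theorem le_one (hp : IsTransitionFunction p) (ht : 0 ≤ t) (i j : ℕ) : p t i j ≤ 1 := by
  simpa using hp.sum_finset_le_one ht i {j}

theorem le_one_sub_diag (hp : IsTransitionFunction p) (ht : 0 ≤ t) {i j : ℕ} (hij : i ≠ j) :
    p t i j ≤ 1 - p t i i := by
  have := hp.sum_finset_le_one ht i {i, j}
  rw [Finset.sum_pair hij] at this
  linarith

theorem mul_le (hp : IsTransitionFunction p) (hs : 0 ≤ s) (ht : 0 ≤ t) (i l j : ℕ) :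
    p s i l * p t l j ≤ p (s + t) i j :=
  le_hasSum (hp.chapman_kolmogorov s t hs ht i j) l fun m _ =>
    mul_nonneg (hp.nonneg s hs i m) (hp.nonneg t ht m j)

theorem diag_pow_le (hp : IsTransitionFunction p) (ht : 0 ≤ t) (i n : ℕ) :
    p t i i ^ n ≤ p (n * t) i i := by
  induction n with
  | zero => simp [hp.zero]
  | succ n ih =>
    calc p t i i ^ (n + 1) = p t i i ^ n * p t i i := pow_succ _ _
      _ ≤ p (n * t) i i * p t i i := mul_le_mul_of_nonneg_right ih (hp.nonneg t ht i i)
      _ ≤ p (n * t + t) i i := hp.mul_le (by positivity) ht i i i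
      _ = p ((n + 1 : ℕ) * t) i i := by push_cast; ring_nf

theorem hasSum_increment (hp : IsTransitionFunction p) (hs : 0 ≤ s) (ht : 0 ≤ t) (i j : ℕ) :
    HasSum (fun l => p s i l * (p t l j - if l = j then 1 else 0)) (p (s + t) i j - p s i j) := by
  refine ((hp.chapman_kolmogorov s t hs ht i j).sub (hasSum_ite_eq j (p s i j))).congr_fun
    fun l => ?_
  rcases eq_or_ne l j with rfl | h
  · simp [mul_sub]
  · simp [h]

theorem occupationTimeUpTo_nonneg (hp : IsTransitionFunction p) (k i : ℕ) (ht : 0 ≤ t) :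
    0 ≤ occupationTimeUpTo p k i t :=
  intervalIntegral.integral_nonneg ht fun r hr => hp.nonneg r hr.1 k i

theorem occupationTime_nonneg (hp : IsTransitionFunction p) (k i : ℕ) :
    0 ≤ occupationTime p k i :=
  setIntegral_nonneg measurableSet_Ioi fun r hr => hp.nonneg r (le_of_lt hr) k i

end IsTransitionFunction

namespace IsQFunction

variable {q : ℕ → ℕ → ℝ} {p : ℝ → ℕ → ℕ → ℝ} {s t K : ℝ}

theorem tendsto_slope (hp : IsQFunction q p) (i j : ℕ) :
    Tendsto (fun h => (p h i j - if i = j then 1 else 0) / h) (𝓝[>] 0) (𝓝 (q i j)) := by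
  have h := hasDerivWithinAt_iff_tendsto_slope.1 (hp.deriv_zero i j)
  rw [Ici_sdiff_left] at h
  refine h.congr fun t => ?_
  rw [slope_def_field, hp.zero, sub_zero]

theorem one_add_mul_le_diag (hp : IsQFunction q p) (i : ℕ) (ht : 0 ≤ t) :
    1 + q i i * t ≤ p t i i := by
  rcases ht.eq_or_lt with rfl | ht
  · simp [hp.zero]
  have hseq : Tendsto (fun n : ℕ => t / n) atTop (𝓝[>] 0) := by
    refine tendsto_nhdsWithin_iff.2 ⟨tendsto_const_div_atTop_nhds_zero_nat t, ?_⟩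
    filter_upwards [eventually_gt_atTop 0] with n hn
    exact div_pos ht (Nat.cast_pos.2 hn)
  refine le_of_tendsto ((((hp.tendsto_slope i i).comp hseq).mul_const t).const_add 1) ?_
  filter_upwards [eventually_gt_atTop 0] with n hn
  have hn' : (0 : ℝ) < n := Nat.cast_pos.2 hn
  have htn : 0 ≤ t / n := by positivity
  calc 1 + (p (t / n) i i - if i = i then 1 else 0) / (t / n) * t
      = 1 + n * (p (t / n) i i - 1) := by rw [if_pos rfl]; field_simp
    _ ≤ (1 + (p (t / n) i i - 1)) ^ n :=
        one_add_mul_le_pow (by linarith [hp.nonneg (t / n) htn i i]) n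
    _ = p (t / n) i i ^ n := by rw [add_sub_cancel]
    _ ≤ p (n * (t / n)) i i := hp.diag_pow_le htn i n
    _ = p t i i := by rw [mul_div_cancel₀ _ hn'.ne']

theorem eq_zero_of_diag_eq_zero (hp : IsQFunction q p) (ht : 0 ≤ t) {i j : ℕ} (hi : q i i = 0)
    (hij : i ≠ j) : p t i j = 0 := by
  have h := hp.one_add_mul_le_diag i ht
  rw [hi] at h
  linarith [hp.nonneg t ht i j, hp.le_one_sub_diag ht hij]

theorem abs_sub_le (hp : IsQFunction q p) (hK : ∀ i, -K ≤ q i i) (i j : ℕ) (ht : 0 ≤ t) :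
    |p t i j - if i = j then 1 else 0| ≤ K * t := by
  have hdiag : 1 - p t i i ≤ K * t := by
    linarith [hp.one_add_mul_le_diag i ht, mul_le_mul_of_nonneg_right (hK i) ht]
  split_ifs with h
  · subst h
    rwa [abs_sub_comm, abs_of_nonneg (sub_nonneg.2 (hp.le_one ht i i))]
  · rw [sub_zero, abs_of_nonneg (hp.nonneg t ht i j)]
    exact (hp.le_one_sub_diag ht h).trans hdiag

theorem abs_increment_le (hp : IsQFunction q p) (hK : ∀ i, -K ≤ q i i) (hs : 0 ≤ s) (ht : 0 ≤ t)
    (i j : ℕ) : |p (s + t) i j - p s i j| ≤ K * t := by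
  have hKt : 0 ≤ K * t := (abs_nonneg _).trans (hp.abs_sub_le hK i i ht)
  calc |p (s + t) i j - p s i j|
      = ‖∑' l, p s i l * (p t l j - if l = j then 1 else 0)‖ := by
        rw [(hp.hasSum_increment hs ht i j).tsum_eq, Real.norm_eq_abs]
    _ ≤ (∑' l, p s i l) * (K * t) := by
        refine tsum_of_norm_bounded ((hp.summable s hs i).hasSum.mul_right _) fun l => ?_
        rw [norm_mul, Real.norm_of_nonneg (hp.nonneg s hs i l)]
        exact mul_le_mul_of_nonneg_left (hp.abs_sub_le hK l j ht) (hp.nonneg s hs i l)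
    _ ≤ K * t := mul_le_of_le_one_left hKt (hp.sum_le_one s hs i)

theorem continuousOn (hp : IsQFunction q p) (hK : ∀ i, -K ≤ q i i) (i j : ℕ) :
    ContinuousOn (fun t => p t i j) (Ici 0) := by
  have dist_le_of_le : ∀ s t : ℝ, 0 ≤ s → s ≤ t → dist (p t i j) (p s i j) ≤ K * dist t s := by
    intro s t hs hst
    rw [Real.dist_eq, Real.dist_eq, abs_of_nonneg (sub_nonneg.2 hst)]
    simpa using hp.abs_increment_le hK hs (sub_nonneg.2 hst) i j
  refine (LipschitzOnWith.of_dist_le' (K := K) fun s hs t ht => ?_).continuousOn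
  rcases le_total s t with h | h
  · rw [dist_comm, dist_comm s]
    exact dist_le_of_le s t hs h
  · exact dist_le_of_le t s ht h

theorem intervalIntegrable (hp : IsQFunction q p) (hK : ∀ i, -K ≤ q i i) (i j : ℕ) (ht : 0 ≤ t) :
    IntervalIntegrable (fun r => p r i j) volume 0 t :=
  ((hp.continuousOn hK i j).mono (uIcc_of_le ht ▸ Icc_subset_Ici_self)).intervalIntegrable

theorem occupationTimeUpTo_le (hp : IsQFunction q p) (hK : ∀ i, -K ≤ q i i) (k i : ℕ)
    (ht : 0 ≤ t) : occupationTimeUpTo p k i t ≤ t := by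
  simpa [occupationTimeUpTo] using intervalIntegral.integral_mono_on ht
    (hp.intervalIntegrable hK k i ht) intervalIntegrable_const fun r hr => hp.le_one hr.1 k i

theorem hasDerivWithinAt (hp : IsQFunction q p) (hK : ∀ i, -K ≤ q i i) (i j : ℕ) (ht : 0 ≤ t) :
    HasDerivWithinAt (fun t => p t i j) (∑' l, p t i l * q l j) (Ioi t) t := by
  rw [hasDerivWithinAt_iff_tendsto_slope' self_notMem_Ioi]
  have hshift : Tendsto (fun r => r - t) (𝓝[>] t) (𝓝[>] 0) := by
    rw [Tendsto, map_subRight_nhdsGT, sub_self]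
  have hlim : Tendsto (fun h => ∑' l, p t i l * ((p h l j - if l = j then 1 else 0) / h)) (𝓝[>] 0)
      (𝓝 (∑' l, p t i l * q l j)) := by
    refine tendsto_tsum_of_dominated_convergence (bound := fun l => p t i l * K)
      ((hp.summable t ht i).mul_right K) (fun l => (hp.tendsto_slope l j).const_mul _) ?_
    filter_upwards [self_mem_nhdsWithin] with h (hh : 0 < h) l
    rw [norm_mul, Real.norm_of_nonneg (hp.nonneg t ht i l), Real.norm_eq_abs, abs_div,
      abs_of_pos hh]
    exact mul_le_mul_of_nonneg_left ((div_le_iff₀ hh).2 (hp.abs_sub_le hK l j hh.le))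
      (hp.nonneg t ht i l)
  refine (hlim.comp hshift).congr' ?_
  filter_upwards [self_mem_nhdsWithin] with r (hr : t < r)
  have h := (hp.hasSum_increment ht (sub_nonneg.2 hr.le) i j).div_const (r - t)
  rw [add_sub_cancel] at h
  rw [slope_def_field, ← h.tsum_eq]
  exact tsum_congr fun l => (mul_div_assoc _ _ _).symm

theorem sum_occupationTimeUpTo_mul (hp : IsQFunction q p) (hK : ∀ i, -K ≤ q i i) (k j : ℕ)
    {F : Finset ℕ} (hF : ∀ l ∉ F, q l j = 0) (ht : 0 ≤ t) :
    ∑ l ∈ F, occupationTimeUpTo p k l t * q l j = p t k j - if k = j then 1 else 0 := by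
  have hint : ∀ l ∈ F, IntervalIntegrable (fun r => p r k l * q l j) volume 0 t := fun l _ =>
    (hp.intervalIntegrable hK k l ht).mul_const _
  have hderiv : ∀ r ∈ Ioo 0 t,
      HasDerivWithinAt (fun r => p r k j) (∑ l ∈ F, p r k l * q l j) (Ioi r) r := fun r hr => by
    have h := hp.hasDerivWithinAt hK k j hr.1.le
    rwa [tsum_eq_sum fun l hl => by rw [hF l hl, mul_zero]] at h
  calc ∑ l ∈ F, occupationTimeUpTo p k l t * q l j
      = ∫ r in (0 : ℝ)..t, ∑ l ∈ F, p r k l * q l j := by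
        simp only [intervalIntegral.integral_finsetSum hint, intervalIntegral.integral_mul_const,
          occupationTimeUpTo]
    _ = p t k j - p 0 k j :=
        intervalIntegral.integral_eq_sub_of_hasDeriv_right_of_le ht
          ((hp.continuousOn hK k j).mono Icc_subset_Ici_self) hderiv
          (by simpa only [Finset.sum_fn] using IntervalIntegrable.sum F hint)
    _ = p t k j - if k = j then 1 else 0 := by rw [hp.zero]

end IsQFunction

/-! ### The `q`-matrix of the stopped queue and its action on row vectors -/

section QMatrix

variable {b : ℕ → ℝ} {c : ℕ}

namespace IsRateSequence

theorem summable_abs (hb : IsRateSequence b) : Summable fun j => |b j| := by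
  refine (hb.hasSum.add (hasSum_ite_eq 1 |b 1|)).summable.congr fun j => ?_
  rcases eq_or_ne j 1 with rfl | h
  · simp
  · simp [h, abs_of_nonneg (hb.nonneg j h)]

theorem hasSum_zero (hb : IsRateSequence b) : HasSum b 0 := by
  have h := hb.hasSum.add (hasSum_ite_eq 1 (b 1))
  rw [neg_add_cancel] at h
  refine h.congr_fun fun j => ?_
  split_ifs with hj <;> simp [hj]

theorem one_nonpos (hb : IsRateSequence b) : b 1 ≤ 0 :=
  neg_nonneg.1 <| hb.hasSum.nonneg fun j => by
    split_ifs with h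
    exacts [le_rfl, hb.nonneg j h]

theorem tsum_tail_nonneg (hb : IsRateSequence b) {n : ℕ} (hn : 2 ≤ n) : 0 ≤ ∑' j, b (j + n) :=
  tsum_nonneg fun j => hb.nonneg _ (by omega)

theorem sum_range_eq_neg_tsum (hb : IsRateSequence b) (n : ℕ) :
    ∑ j ∈ Finset.range n, b j = -∑' j, b (j + n) := by
  rw [eq_neg_iff_add_eq_zero, hb.hasSum_zero.summable.sum_add_tsum_nat_add, hb.hasSum_zero.tsum_eq]

end IsRateSequence

theorem qStar_zero_left (j : ℕ) : qStar b c 0 j = 0 := by simp [qStar]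

theorem qStar_eq_zero {i j : ℕ} (h : j + 2 ≤ i) : qStar b c i j = 0 := by
  unfold qStar
  rw [if_neg (by omega), if_neg (by omega), if_neg (by omega)]

theorem qStar_diag {i : ℕ} (hi : 1 ≤ i) :
    qStar b c i i = b 1 - (((min i c : ℕ) : ℝ) - 1) * b 0 := by
  unfold qStar
  rw [if_neg (by omega), if_pos ⟨hi, rfl⟩]

theorem qStar_succ_left (j : ℕ) : qStar b c (j + 1) j = ((min (j + 1) c : ℕ) : ℝ) * b 0 := by
  unfold qStar
  rw [if_pos ⟨by omega, rfl⟩]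

theorem qStar_of_lt {i j : ℕ} (hi : 1 ≤ i) (hij : i < j) : qStar b c i j = b (j - i + 1) := by
  unfold qStar
  rw [if_neg (by omega), if_neg (by omega), if_pos ⟨hi, hij⟩]

theorem neg_le_qStar_diag (hb : IsRateSequence b) (hc : 1 ≤ c) (i : ℕ) :
    -(-b 1 + ((c : ℝ) - 1) * b 0) ≤ qStar b c i i := by
  have h1 := hb.one_nonpos
  have h0 := hb.zero_pos
  have hc' : (1 : ℝ) ≤ c := by exact_mod_cast hc
  rcases Nat.eq_zero_or_pos i with rfl | hi
  · rw [qStar_zero_left]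
    nlinarith
  · rw [qStar_diag hi]
    have : ((min i c : ℕ) : ℝ) ≤ c := by exact_mod_cast min_le_right i c
    nlinarith

/-- The `i`-th row is that of a random walk with rates `b`, corrected by `min i c - 1` further
servers. -/
theorem qStar_succ_eq (i j : ℕ) : qStar b c (i + 1) j = (if i ≤ j then b (j - i) else 0) +
    (((min (i + 1) c : ℕ) : ℝ) - 1) * b 0 *
      ((if j = i then 1 else 0) - if j = i + 1 then 1 else 0) := by
  rcases lt_trichotomy j (i + 1) with h | rfl | h
  · rcases eq_or_ne j i with rfl | h'
    · rw [qStar_succ_left, if_pos le_rfl, if_pos rfl, if_neg (by omega), Nat.sub_self]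
      ring
    · rw [qStar_eq_zero (by omega), if_neg (by omega), if_neg h', if_neg (by omega)]
      ring
  · rw [qStar_diag (by omega), if_pos (by omega), if_neg (by omega), if_pos rfl,
      show i + 1 - i = 1 by omega]
    ring
  · rw [qStar_of_lt (by omega) h, if_pos (by omega), if_neg (by omega), if_neg (by omega),
      show j - (i + 1) + 1 = j - i by omega]
    ring

theorem sum_range_qStar (hb : IsRateSequence b) {i M : ℕ} (hiM : i < M) :
    ∑ j ∈ Finset.range (M + 1), qStar b c (i + 1) j = -∑' j, b (j + (M - i + 1)) := by
  have hwalk : ∑ j ∈ Finset.range (M + 1), (if i ≤ j then b (j - i) else 0) =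
      ∑ j ∈ Finset.range (M - i + 1), b j := by
    rw [show M + 1 = i + (M - i + 1) by omega, Finset.sum_range_add,
      Finset.sum_eq_zero fun j hj => if_neg (not_le.2 (Finset.mem_range.1 hj)), zero_add]
    simp
  simp only [qStar_succ_eq, Finset.sum_add_distrib, ← Finset.mul_sum, Finset.sum_sub_distrib,
    Finset.sum_ite_eq', Finset.mem_range]
  rw [hwalk, if_pos (by omega), if_pos (by omega), hb.sum_range_eq_neg_tsum]
  ring

/-- The `j`-th coordinate of the row vector `w Q*`. The sum is finite, since the queue cannot jump
down by more than one. -/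
def vecMulQStar (b : ℕ → ℝ) (c : ℕ) (w : ℕ → ℝ) (j : ℕ) : ℝ :=
  ∑ l ∈ Finset.range (j + 2), w l * qStar b c l j

theorem vecMulQStar_zero (hc : 1 ≤ c) (w : ℕ → ℝ) : vecMulQStar b c w 0 = b 0 * w 1 := by
  rw [vecMulQStar, Finset.sum_range_succ, Finset.sum_range_one, qStar_zero_left, qStar_succ_left,
    Nat.min_eq_left hc]
  push_cast
  ring

theorem sum_Icc_one_eq_sum_range {M : Type*} [AddCommMonoid M] (f : ℕ → M) (n : ℕ) :
    ∑ i ∈ Finset.Icc 1 n, f i = ∑ i ∈ Finset.range n, f (i + 1) := by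
  rw [Finset.range_eq_Ico, Finset.sum_Ico_add', zero_add, Finset.Ico_add_one_right_eq_Icc]

theorem vecMulQStar_of_pos (w : ℕ → ℝ) {j : ℕ} (hj : 1 ≤ j) :
    vecMulQStar b c w j = ∑ i ∈ Finset.Icc 1 (j - 1), b (j - i + 1) * w i
      + (b 1 - (((min j c : ℕ) : ℝ) - 1) * b 0) * w j
      + ((min (j + 1) c : ℕ) : ℝ) * b 0 * w (j + 1) := by
  obtain ⟨n, rfl⟩ : ∃ n, j = n + 1 := ⟨j - 1, by omega⟩
  rw [vecMulQStar, Finset.sum_range_succ, Finset.sum_range_succ, Finset.sum_range_succ',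
    qStar_zero_left, mul_zero, add_zero, qStar_diag hj, qStar_succ_left,
    mul_comm (w (n + 1)), mul_comm (w (n + 1 + 1)), Nat.add_sub_cancel, sum_Icc_one_eq_sum_range]
  congr 2
  refine Finset.sum_congr rfl fun i hi => ?_
  rw [qStar_of_lt (by omega) (by simpa using hi), mul_comm]

theorem vecMulQStar_sub (w w' : ℕ → ℝ) (j : ℕ) :
    vecMulQStar b c (fun i => w i - w' i) j = vecMulQStar b c w j - vecMulQStar b c w' j := by
  simp only [vecMulQStar, sub_mul, Finset.sum_sub_distrib]

/-- Balance of the flow across the level `M`: downwards from `M + 1` and upwards out of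
`{1, …, M}`. -/
theorem sum_vecMulQStar (hb : IsRateSequence b) (w : ℕ → ℝ) (M : ℕ) :
    ∑ j ∈ Finset.range (M + 1), vecMulQStar b c w j =
      ((min (M + 1) c : ℕ) : ℝ) * b 0 * w (M + 1) -
        ∑ i ∈ Finset.range M, w (i + 1) * ∑' j, b (j + (M - i + 1)) := by
  have hext : ∀ j ∈ Finset.range (M + 1),
      vecMulQStar b c w j = ∑ l ∈ Finset.range (M + 2), w l * qStar b c l j := fun j hj => by
    refine Finset.sum_subset (Finset.range_mono ?_) fun l _ hl => ?_
    · have := Finset.mem_range.1 hj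
      omega
    · rw [qStar_eq_zero (by simpa using hl), mul_zero]
  have hlast : ∑ j ∈ Finset.range (M + 1), qStar b c (M + 1) j =
      ((min (M + 1) c : ℕ) : ℝ) * b 0 := by
    rw [Finset.sum_range_succ, qStar_succ_left, Finset.sum_eq_zero fun j hj => ?_, zero_add]
    have := Finset.mem_range.1 hj
    exact qStar_eq_zero (by omega)
  rw [Finset.sum_congr rfl hext, Finset.sum_comm]
  simp only [← Finset.mul_sum]
  rw [Finset.sum_range_succ, hlast, Finset.sum_range_succ',
    Finset.sum_eq_zero fun j _ => qStar_zero_left j, mul_zero, add_zero,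
    Finset.sum_congr rfl fun i hi => by rw [sum_range_qStar hb (Finset.mem_range.1 hi)]]
  simp only [mul_neg, Finset.sum_neg_distrib]
  ring

theorem service_rate_pos (hb : IsRateSequence b) (hc : 1 ≤ c) (j : ℕ) :
    0 < ((min (j + 1) c : ℕ) : ℝ) * b 0 :=
  mul_pos (Nat.cast_pos.2 (lt_min j.succ_pos hc)) hb.zero_pos

theorem nonneg_of_vecMulQStar_nonneg (hb : IsRateSequence b) (hc : 1 ≤ c) {w : ℕ → ℝ} {N : ℕ}
    (h : ∀ j < N, 0 ≤ vecMulQStar b c w j) {i : ℕ} (hi : 1 ≤ i) (hiN : i ≤ N) : 0 ≤ w i := by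
  induction i using Nat.strong_induction_on with
  | _ i ih =>
  obtain ⟨M, rfl⟩ : ∃ M, i = M + 1 := ⟨i - 1, by omega⟩
  refine nonneg_of_mul_nonneg_right ?_ (service_rate_pos hb hc M)
  rw [← sub_add_cancel (_ * w (M + 1)), ← sum_vecMulQStar hb w M]
  refine add_nonneg (Finset.sum_nonneg fun j hj => h j ?_) (Finset.sum_nonneg fun i hi => ?_)
  · exact (Finset.mem_range.1 hj).trans_le hiN
  · have := Finset.mem_range.1 hi
    exact mul_nonneg (ih (i + 1) (by omega) (by omega) (by omega))
      (hb.tsum_tail_nonneg (by omega))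

theorem le_of_vecMulQStar_le (hb : IsRateSequence b) (hc : 1 ≤ c) {w w' : ℕ → ℝ} {N : ℕ}
    (h : ∀ j < N, vecMulQStar b c w j ≤ vecMulQStar b c w' j) {i : ℕ} (hi : 1 ≤ i) (hiN : i ≤ N) :
    w i ≤ w' i := by
  refine sub_nonneg.1 (nonneg_of_vecMulQStar_nonneg hb hc (w := fun i => w' i - w i)
    (fun j hj => ?_) hi hiN)
  rw [vecMulQStar_sub]
  exact sub_nonneg.2 (h j hj)

/-! ### The linear systems -/

section LinearSystems

variable {k : ℕ} {u e e' : ℝ} {m m' : ℕ → ℝ}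

theorem OccupationRecursion.vecMulQStar_eq (h : OccupationRecursion b c k e m) (hc : 1 ≤ c)
    (j : ℕ) : vecMulQStar b c m j = if j = 0 then e else -(if k = j then 1 else 0) := by
  rcases Nat.eq_zero_or_pos j with rfl | hj
  · rw [vecMulQStar_zero hc, h.absorb, if_pos rfl]
  · rw [vecMulQStar_of_pos m hj, h.balance j hj, if_neg hj.ne']

theorem OccupationRecursion.unique (hb : IsRateSequence b) (hc : 1 ≤ c)
    (h : OccupationRecursion b c k e m) (h' : OccupationRecursion b c k e m') (i : ℕ)
    (hi : 1 ≤ i) : m i = m' i := by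
  have heq : ∀ j, vecMulQStar b c m j = vecMulQStar b c m' j := fun j =>
    (h.vecMulQStar_eq hc j).trans (h'.vecMulQStar_eq hc j).symm
  exact (le_of_vecMulQStar_le hb hc (fun j _ => (heq j).le) hi le_rfl).antisymm
    (le_of_vecMulQStar_le hb hc (fun j _ => (heq j).ge) hi le_rfl)

theorem OccupationRecursion.extinctionSystem (h : OccupationRecursion b c k e m)
    (hroot : e = u ^ k -
      ∑ i ∈ Finset.Icc 1 (c - 1), m i * u ^ (i - 1) * ((c : ℝ) - (i : ℝ)) * b 0 * (1 - u)) :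
    ExtinctionSystem b c k u e m where
  root := hroot
  absorb _ := h.absorb
  balance j hj hjc := by
    have := h.balance j hj
    rw [Nat.min_eq_left (by omega), Nat.min_eq_left (by omega)] at this
    exact_mod_cast this

namespace ExtinctionSystem

theorem vecMulQStar_eq (h : ExtinctionSystem b c k u e m) {j : ℕ} (hj : j + 2 ≤ c) :
    vecMulQStar b c m j = if j = 0 then e else -(if k = j then 1 else 0) := by
  rcases Nat.eq_zero_or_pos j with rfl | hj0
  · rw [vecMulQStar_zero (by omega), h.absorb hj, if_pos rfl]
  · rw [vecMulQStar_of_pos m hj0, Nat.min_eq_left (by omega), Nat.min_eq_left (by omega),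
      if_neg hj0.ne']
    exact_mod_cast h.balance j hj0 hj

theorem le_of_le (hb : IsRateSequence b) (hc : 1 ≤ c) (h : ExtinctionSystem b c k u e m)
    (h' : ExtinctionSystem b c k u e' m') (he : e ≤ e') {i : ℕ} (hi : 1 ≤ i) (hic : i ≤ c - 1) :
    m i ≤ m' i := by
  refine le_of_vecMulQStar_le hb hc (fun j hj => ?_) hi hic
  rw [h.vecMulQStar_eq (by omega), h'.vecMulQStar_eq (by omega)]
  split_ifs <;> simp [he]

theorem prob_le (hb : IsRateSequence b) (hc : 1 ≤ c) (hu : u ∈ Icc (0 : ℝ) 1)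
    (h : ExtinctionSystem b c k u e m) (h' : ExtinctionSystem b c k u e' m') : e ≤ e' := by
  by_contra! hlt
  refine absurd hlt (not_lt.2 ?_)
  rw [h.root, h'.root]
  refine sub_le_sub_left (Finset.sum_le_sum fun i hi => ?_) _
  obtain ⟨hi1, hic⟩ := Finset.mem_Icc.1 hi
  have hci : 0 ≤ (c : ℝ) - i := sub_nonneg.2 (Nat.cast_le.2 (by omega))
  have := hb.zero_pos
  have := sub_nonneg.2 hu.2
  have := hu.1
  have := h'.le_of_le hb hc h hlt.le hi1 hic
  gcongr

theorem unique (hb : IsRateSequence b) (hc : 1 ≤ c) (hu : u ∈ Icc (0 : ℝ) 1)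
    (h : ExtinctionSystem b c k u e m) (h' : ExtinctionSystem b c k u e' m') :
    e = e' ∧ ∀ i, 1 ≤ i → i ≤ c - 1 → m i = m' i := by
  have he := h.prob_le hb hc hu h'
  have he' := h'.prob_le hb hc hu h
  exact ⟨he.antisymm he', fun i hi hic =>
    (h.le_of_le hb hc h' he hi hic).antisymm (h'.le_of_le hb hc h he' hi hic)⟩

end ExtinctionSystem

end LinearSystems

end QMatrix

/-! ### Occupation times of the queue -/

section QueueOccupation

variable {b : ℕ → ℝ} {c : ℕ} {p : ℝ → ℕ → ℕ → ℝ} {k : ℕ} {t : ℝ}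

namespace IsQFunction

theorem vecMulQStar_occupationTimeUpTo (hp : IsQFunction (qStar b c) p) (hb : IsRateSequence b)
    (hc : 1 ≤ c) (k j : ℕ) (ht : 0 ≤ t) :
    vecMulQStar b c (fun i => occupationTimeUpTo p k i t) j =
      p t k j - if k = j then 1 else 0 :=
  hp.sum_occupationTimeUpTo_mul (neg_le_qStar_diag hb hc) k j
    (fun _ hl => qStar_eq_zero (by simpa using hl)) ht

theorem exists_occupationTimeUpTo_le (hp : IsQFunction (qStar b c) p) (hb : IsRateSequence b)
    (hc : 1 ≤ c) (k : ℕ) {i : ℕ} (hi : 1 ≤ i) :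
    ∃ C, ∀ t, 0 ≤ t → occupationTimeUpTo p k i t ≤ C := by
  induction i using Nat.strong_induction_on with
  | _ i ih =>
  obtain ⟨M, rfl⟩ : ∃ M, i = M + 1 := ⟨i - 1, by omega⟩
  have hlower : ∀ i ∈ Finset.range M, ∃ C, ∀ t, 0 ≤ t → occupationTimeUpTo p k (i + 1) t ≤ C :=
    fun i hi => ih (i + 1) (by simpa using hi) (by omega)
  choose! C hC using hlower
  refine ⟨(1 + ∑ i ∈ Finset.range M, C i * ∑' j, b (j + (M - i + 1))) /
    (((min (M + 1) c : ℕ) : ℝ) * b 0), fun t ht => (le_div_iff₀ (service_rate_pos hb hc M)).2 ?_⟩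
  have hflow := sum_vecMulQStar (c := c) hb (fun i => occupationTimeUpTo p k i t) M
  have hmass : ∑ j ∈ Finset.range (M + 1),
      vecMulQStar b c (fun i => occupationTimeUpTo p k i t) j ≤ 1 := by
    refine (Finset.sum_le_sum fun j _ => ?_).trans (hp.sum_finset_le_one ht k _)
    rw [hp.vecMulQStar_occupationTimeUpTo hb hc k j ht]
    split_ifs <;> linarith
  have hup : ∑ i ∈ Finset.range M,
      occupationTimeUpTo p k (i + 1) t * ∑' j, b (j + (M - i + 1)) ≤
        ∑ i ∈ Finset.range M, C i * ∑' j, b (j + (M - i + 1)) := by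
    refine Finset.sum_le_sum fun i hi => mul_le_mul_of_nonneg_right (hC i hi t ht) ?_
    have := Finset.mem_range.1 hi
    exact hb.tsum_tail_nonneg (by omega)
  linarith

theorem integrableOn (hp : IsQFunction (qStar b c) p) (hb : IsRateSequence b) (hc : 1 ≤ c)
    (k : ℕ) {i : ℕ} (hi : 1 ≤ i) : IntegrableOn (fun t => p t k i) (Ioi 0) := by
  obtain ⟨C, hC⟩ := hp.exists_occupationTimeUpTo_le hb hc k hi
  refine integrableOn_Ioi_of_intervalIntegral_norm_bounded (l := atTop) (b := fun n : ℕ => (n : ℝ))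
    C 0 (fun n => ?_) tendsto_natCast_atTop_atTop (Eventually.of_forall fun n => ?_)
  · exact (intervalIntegrable_iff_integrableOn_Ioc_of_le n.cast_nonneg).1
      (hp.intervalIntegrable (neg_le_qStar_diag hb hc) k i n.cast_nonneg)
  · refine le_of_eq_of_le (intervalIntegral.integral_congr fun r hr => ?_) (hC n n.cast_nonneg)
    rw [uIcc_of_le n.cast_nonneg] at hr
    exact Real.norm_of_nonneg (hp.nonneg r hr.1 k i)

theorem tendsto_occupationTimeUpTo (hp : IsQFunction (qStar b c) p) (hb : IsRateSequence b)
    (hc : 1 ≤ c) (k : ℕ) {i : ℕ} (hi : 1 ≤ i) :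
    Tendsto (occupationTimeUpTo p k i) atTop (𝓝 (occupationTime p k i)) :=
  intervalIntegral_tendsto_integral_Ioi 0 (hp.integrableOn hb hc k hi) tendsto_id

theorem tendsto_transition (hp : IsQFunction (qStar b c) p) (hb : IsRateSequence b)
    (hc : 1 ≤ c) (k j : ℕ) :
    Tendsto (fun t => p t k j) atTop
      (𝓝 (vecMulQStar b c (occupationTime p k) j + if k = j then 1 else 0)) := by
  have h : Tendsto (fun t => vecMulQStar b c (fun i => occupationTimeUpTo p k i t) j) atTop
      (𝓝 (vecMulQStar b c (occupationTime p k) j)) := by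
    refine tendsto_finsetSum _ fun l _ => ?_
    rcases Nat.eq_zero_or_pos l with rfl | hl
    · simp [qStar_zero_left]
    · exact (hp.tendsto_occupationTimeUpTo hb hc k hl).mul_const _
  refine (h.add_const (if k = j then (1 : ℝ) else 0)).congr' ?_
  filter_upwards [eventually_ge_atTop 0] with t ht
  rw [hp.vecMulQStar_occupationTimeUpTo hb hc k j ht, sub_add_cancel]

theorem tendsto_absorbed (hp : IsQFunction (qStar b c) p) (hb : IsRateSequence b) (hc : 1 ≤ c)
    (hk : 1 ≤ k) : Tendsto (fun t => p t k 0) atTop (𝓝 (b 0 * occupationTime p k 1)) := by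
  have h := hp.tendsto_transition hb hc k 0
  rwa [vecMulQStar_zero hc, if_neg (by omega), add_zero] at h

theorem absorbed_le_one (hp : IsQFunction (qStar b c) p) (hb : IsRateSequence b) (hc : 1 ≤ c)
    (hk : 1 ≤ k) : b 0 * occupationTime p k 1 ≤ 1 := by
  refine le_of_tendsto (hp.tendsto_absorbed hb hc hk) ?_
  filter_upwards [eventually_ge_atTop 0] with t ht using hp.le_one ht k 0

theorem vecMulQStar_occupationTime (hp : IsQFunction (qStar b c) p) (hb : IsRateSequence b)
    (hc : 1 ≤ c) (k : ℕ) {j : ℕ} (hj : 1 ≤ j) :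
    vecMulQStar b c (occupationTime p k) j = -(if k = j then 1 else 0) :=
  eq_neg_of_add_eq_zero_left <|
    IntegrableAtFilter.eq_zero_of_tendsto ⟨Ioi 0, Ioi_mem_atTop 0, hp.integrableOn hb hc k hj⟩
      (fun s hs => by
        obtain ⟨T, hT⟩ := mem_atTop_sets.1 hs
        exact measure_mono_top hT Real.volume_Ici)
      (hp.tendsto_transition hb hc k j)

theorem occupationRecursion (hp : IsQFunction (qStar b c) p) (hb : IsRateSequence b)
    (hc : 1 ≤ c) (k : ℕ) :
    OccupationRecursion b c k (b 0 * occupationTime p k 1) (occupationTime p k) where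
  absorb := rfl
  balance j hj := by rw [← vecMulQStar_of_pos _ hj, hp.vecMulQStar_occupationTime hb hc k hj]

end IsQFunction

end QueueOccupation

/-! ### Generating functions -/

section GeneratingFunctions

variable {b : ℕ → ℝ} {c : ℕ} {s : ℝ} {w : ℕ → ℝ}

theorem norm_mul_pow_le_abs (hs : s ∈ Icc (0 : ℝ) 1) (x : ℝ) (j : ℕ) : ‖x * s ^ j‖ ≤ |x| := by
  rw [norm_mul, Real.norm_eq_abs, norm_pow, Real.norm_of_nonneg hs.1]
  exact mul_le_of_le_one_right (abs_nonneg _) (pow_le_one₀ hs.1 hs.2)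

theorem IsRateSequence.summable_norm_mul_pow (hb : IsRateSequence b) (hs : s ∈ Icc (0 : ℝ) 1) :
    Summable fun j => ‖b j * s ^ j‖ :=
  hb.summable_abs.of_nonneg_of_le (fun _ => norm_nonneg _) fun j => norm_mul_pow_le_abs hs (b j) j

theorem vecMulQStar_eq_convolution (w : ℕ → ℝ) (j : ℕ) :
    vecMulQStar b c w j = ∑ i ∈ Finset.range (j + 1), w (i + 1) * b (j - i) +
      ((((min (j + 1) c : ℕ) : ℝ) - 1) * b 0 * w (j + 1) -
        if j = 0 then 0 else (((min j c : ℕ) : ℝ) - 1) * b 0 * w j) := by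
  rw [vecMulQStar, Finset.sum_range_succ', qStar_zero_left, mul_zero, add_zero]
  simp only [qStar_succ_eq, mul_add, mul_sub, Finset.sum_add_distrib, Finset.sum_sub_distrib,
    mul_ite, mul_one, mul_zero]
  refine congr_arg₂ _ (Finset.sum_congr rfl fun i hi => if_pos ?_) (congr_arg₂ _ ?_ ?_)
  · exact Nat.lt_succ_iff.1 (Finset.mem_range.1 hi)
  · rw [Finset.sum_ite_eq, if_pos (Finset.self_mem_range_succ j), mul_comm]
  · rcases j with _ | j
    · simp
    · simp [mul_comm]

theorem hasSum_convolution_mul_pow (hb : IsRateSequence b) (hs : s ∈ Icc (0 : ℝ) 1)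
    (hw : Summable fun i => ‖w (i + 1) * s ^ i‖) :
    HasSum (fun j => (∑ i ∈ Finset.range (j + 1), w (i + 1) * b (j - i)) * s ^ j)
      ((∑' i, w (i + 1) * s ^ i) * genB b s) := by
  have hbs := hb.summable_norm_mul_pow hs
  rw [genB, tsum_mul_tsum_eq_tsum_sum_range_of_summable_norm hw hbs]
  refine (summable_norm_sum_mul_range_of_summable_norm hw hbs).of_norm.hasSum.congr_fun fun j => ?_
  rw [Finset.sum_mul]
  refine Finset.sum_congr rfl fun i hi => ?_
  rw [← Nat.add_sub_cancel' (Nat.lt_succ_iff.1 (Finset.mem_range.1 hi)), pow_add,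
    Nat.add_sub_cancel_left]
  ring

theorem hasSum_idle_servers (c : ℕ) (w : ℕ → ℝ) (s : ℝ) :
    HasSum (fun i => ((c : ℝ) - ((min (i + 1) c : ℕ) : ℝ)) * (w (i + 1) * s ^ i))
      (∑ i ∈ Finset.Icc 1 (c - 1), w i * s ^ (i - 1) * ((c : ℝ) - i)) := by
  rw [sum_Icc_one_eq_sum_range, Finset.sum_congr rfl fun i hi => ?_]
  · refine hasSum_sum_of_ne_finset_zero fun i hi => ?_
    rw [Finset.mem_range] at hi
    rw [Nat.min_eq_right (by omega), sub_self, zero_mul]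
  · rw [Finset.mem_range] at hi
    rw [Nat.add_sub_cancel, Nat.min_eq_left (by omega), mul_comm]

theorem hasSum_shift_mul_pow {v : ℕ → ℝ} {V : ℝ} (h : HasSum (fun i => v (i + 1) * s ^ i) V) :
    HasSum (fun j => (if j = 0 then 0 else v j) * s ^ j) (s * V) := by
  rw [← hasSum_nat_add_iff' 1]
  simp only [Finset.sum_range_one, if_true, zero_mul, sub_zero, Nat.add_eq_zero_iff, one_ne_zero,
    and_false, if_false]
  exact (h.mul_left s).congr_fun fun j => by ring

theorem hasSum_vecMulQStar_mul_pow (hb : IsRateSequence b) (hs : s ∈ Icc (0 : ℝ) 1)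
    (hw : Summable fun i => ‖w (i + 1) * s ^ i‖) :
    HasSum (fun j => vecMulQStar b c w j * s ^ j)
      (genBi b c s * ∑' i, w (i + 1) * s ^ i -
        (1 - s) * b 0 * ∑ i ∈ Finset.Icc 1 (c - 1), w i * s ^ (i - 1) * ((c : ℝ) - i)) := by
  have hextra : HasSum (fun i => (((min (i + 1) c : ℕ) : ℝ) - 1) * b 0 * w (i + 1) * s ^ i)
      (b 0 * (((c : ℝ) - 1) * ∑' i, w (i + 1) * s ^ i -
        ∑ i ∈ Finset.Icc 1 (c - 1), w i * s ^ (i - 1) * ((c : ℝ) - i))) :=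
    (((hw.of_norm.hasSum.mul_left ((c : ℝ) - 1)).sub (hasSum_idle_servers c w s)).mul_left
      (b 0)).congr_fun fun i => by ring
  have hshift := hasSum_shift_mul_pow (v := fun i => (((min i c : ℕ) : ℝ) - 1) * b 0 * w i) hextra
  convert (hasSum_convolution_mul_pow hb hs hw).add (hextra.sub hshift) using 1
  · funext j
    rw [vecMulQStar_eq_convolution]
    ring
  · rw [genBi]
    ring

/-- The right-hand side of `B_c(s) ∑ m_i s^(i-1) = e - s^k + (1-s) b_0 ∑_{i<c} (c-i) m_i s^(i-1)`,
the equation for the generating function of the occupation times. -/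
def occupationNumerator (b : ℕ → ℝ) (c k : ℕ) (e : ℝ) (m : ℕ → ℝ) (s : ℝ) : ℝ :=
  e - s ^ k + (1 - s) * b 0 * ∑ i ∈ Finset.Icc 1 (c - 1), m i * s ^ (i - 1) * ((c : ℝ) - i)

theorem continuous_occupationNumerator (k : ℕ) (e : ℝ) (m : ℕ → ℝ) :
    Continuous (occupationNumerator b c k e m) := by
  unfold occupationNumerator
  fun_prop

theorem genBi_mul_tsum_of_vecMulQStar_eq (hb : IsRateSequence b) {k : ℕ} {f : ℕ → ℝ} {F : ℝ}
    (hwf : ∀ j, vecMulQStar b c w j = f j - if k = j then 1 else 0) (hs : s ∈ Icc (0 : ℝ) 1)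
    (hw : Summable fun i => ‖w (i + 1) * s ^ i‖) (hf : HasSum (fun j => f j * s ^ j) F) :
    genBi b c s * ∑' i, w (i + 1) * s ^ i = occupationNumerator b c k F w s := by
  have h := (hf.sub (hasSum_ite_eq k (s ^ k))).unique <|
    (hasSum_vecMulQStar_mul_pow (c := c) hb hs hw).congr_fun fun j => by
      rw [hwf, sub_mul, ite_mul, one_mul, zero_mul]
      rcases eq_or_ne j k with rfl | hjk
      · simp
      · rw [if_neg hjk, if_neg hjk.symm]
  rw [occupationNumerator, h]
  ring

theorem OccupationRecursion.genBi_mul_tsum {k : ℕ} {e : ℝ} (h : OccupationRecursion b c k e w)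
    (hb : IsRateSequence b) (hc : 1 ≤ c) (hk : 1 ≤ k) (hs : s ∈ Icc (0 : ℝ) 1)
    (hw : Summable fun i => w (i + 1) * s ^ i) :
    genBi b c s * ∑' i, w (i + 1) * s ^ i = occupationNumerator b c k e w s := by
  refine genBi_mul_tsum_of_vecMulQStar_eq hb (f := fun j => if j = 0 then e else 0) (fun j => ?_) hs
    hw.norm ((hasSum_ite_eq 0 e).congr_fun fun j => ?_)
  · rw [h.vecMulQStar_eq hc]
    rcases eq_or_ne j 0 with rfl | hj
    · rw [if_pos rfl, if_pos rfl, if_neg (by omega), sub_zero]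
    · rw [if_neg hj, if_neg hj, zero_sub]
  · rcases eq_or_ne j 0 with rfl | hj <;> simp [*]

/-! ### The roots of `B_i` -/

section Roots

variable {i : ℕ} {u : ℝ}

theorem IsRateSequence.genBi_one (hb : IsRateSequence b) (i : ℕ) : genBi b i 1 = 0 := by
  simp [genBi, genB, hb.hasSum_zero.tsum_eq]

theorem genBi_zero (i : ℕ) : genBi b i 0 = i * b 0 := by
  rw [genBi, genB, tsum_eq_single 0 fun j hj => by simp [hj]]
  ring

theorem IsRateSequence.continuousOn_genBi (hb : IsRateSequence b) (i : ℕ) :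
    ContinuousOn (genBi b i) (Icc 0 1) := by
  have h : ContinuousOn (genB b) (Icc 0 1) :=
    continuousOn_tsum (fun j => by fun_prop) hb.summable_abs fun j s hs =>
      norm_mul_pow_le_abs hs (b j) j
  unfold genBi
  fun_prop

theorem IsRateSequence.slope_genBi (hb : IsRateSequence b) (i : ℕ) (s : ℝ) :
    slope (genBi b i) 1 s = genBi b i s / (s - 1) := by
  rw [slope_def_field, hb.genBi_one, sub_zero]

theorem genBiDerivOne_ne_bot (i : ℕ) : genBiDerivOne b i ≠ ⊥ := by
  rw [genBiDerivOne, Ne, EReal.add_eq_bot_iff]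
  exact not_or.2 ⟨EReal.coe_ennreal_ne_bot _, EReal.coe_ne_bot _⟩

theorem tendsto_slope_genBi_toReal (hb : IsRateSequence b) (h : genBiDerivOne b i ≠ ⊤) :
    Tendsto (slope (genBi b i) 1) (𝓝[<] 1) (𝓝 (genBiDerivOne b i).toReal) :=
  (EReal.tendsto_toReal h (genBiDerivOne_ne_bot i)).comp (tendsto_slope_genBi hb i)

theorem IsRateSequence.exists_pos (hb : IsRateSequence b) : ∃ j, 2 ≤ j ∧ 0 < b j := by
  by_contra! h
  exact hb.tail_pos.not_ge (tsum_nonpos fun j => h (j + 2) (by omega))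

theorem IsRateSequence.strictConvexOn_genB (hb : IsRateSequence b) :
    StrictConvexOn ℝ (Icc 0 1) (genB b) := by
  refine ⟨convex_Icc 0 1, fun x hx y hy hxy α β hα hβ hαβ => ?_⟩
  have hsum : ∀ {z : ℝ}, z ∈ Icc (0 : ℝ) 1 → Summable fun j => b j * z ^ j := fun hz =>
    (hb.summable_norm_mul_pow hz).of_norm
  obtain ⟨j, hj, hbj⟩ := hb.exists_pos
  simp only [genB, smul_eq_mul]
  rw [← tsum_mul_left, ← tsum_mul_left, ← ((hsum hx).mul_left α).tsum_add ((hsum hy).mul_left β)]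
  refine Summable.tsum_lt_tsum (i := j) (fun l => ?_) ?_
    (hsum (convex_Icc 0 1 hx hy hα.le hβ.le hαβ))
    (((hsum hx).mul_left α).add ((hsum hy).mul_left β))
  · rcases eq_or_ne l 1 with rfl | hl
    · exact le_of_eq (by ring)
    · have h := (convexOn_pow l).2 (Icc_subset_Ici_self hx) (Icc_subset_Ici_self hy) hα.le hβ.le hαβ
      simp only [smul_eq_mul] at h
      linarith [mul_le_mul_of_nonneg_left h (hb.nonneg l hl)]
  · have h := (strictConvexOn_pow hj).2 (Icc_subset_Ici_self hx) (Icc_subset_Ici_self hy) hxy hα hβ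
      hαβ
    simp only [smul_eq_mul] at h
    linarith [mul_lt_mul_of_pos_left h hbj]

theorem IsRateSequence.strictMonoOn_slope_genBi (hb : IsRateSequence b) (i : ℕ) :
    StrictMonoOn (slope (genBi b i) 1) (Ico 0 1) := fun x hx y hy hxy => by
  have h := hb.strictConvexOn_genB.secant_strict_mono (right_mem_Icc.2 zero_le_one)
    (Ico_subset_Icc_self hx) (Ico_subset_Icc_self hy) hx.2.ne hy.2.ne hxy
  have haffine : ∀ z ∈ Ico (0 : ℝ) 1,
      slope (genBi b i) 1 z = (genB b z - genB b 1) / (z - 1) - ((i : ℝ) - 1) * b 0 := by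
    intro z hz
    have : z - 1 ≠ 0 := (sub_neg.2 hz.2).ne
    rw [slope_def_field, genBi, genBi]
    field_simp
    ring
  rw [haffine x hx, haffine y hy]
  exact sub_lt_sub_right h _

theorem slope_genBi_lt_genBiDerivOne (hb : IsRateSequence b) (i : ℕ) (hs : s ∈ Ico (0 : ℝ) 1) :
    (slope (genBi b i) 1 s : EReal) < genBiDerivOne b i := by
  have hmono := hb.strictMonoOn_slope_genBi i
  obtain ⟨r, hsr, hr⟩ := exists_between hs.2
  have hr' : r ∈ Ico (0 : ℝ) 1 := ⟨hs.1.trans hsr.le, hr⟩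
  refine (EReal.coe_lt_coe_iff.2 (hmono hs hr' hsr)).trans_le ?_
  refine ge_of_tendsto (tendsto_slope_genBi hb i) ?_
  filter_upwards [Ioo_mem_nhdsLT hr] with x hx
  exact EReal.coe_le_coe_iff.2 (hmono hr' ⟨hr'.1.trans hx.1.le, hx.2⟩ hx.1).le

theorem genBi_pos (hb : IsRateSequence b) (hd : genBiDerivOne b i ≤ 0) (hs : s ∈ Ico (0 : ℝ) 1) :
    0 < genBi b i s := by
  have h := (slope_genBi_lt_genBiDerivOne hb i hs).trans_le hd
  rw [hb.slope_genBi] at h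
  have h' : genBi b i s / (s - 1) < 0 := by exact_mod_cast h
  by_contra! hneg
  exact h'.not_ge (div_nonneg_of_nonpos hneg (sub_neg.2 hs.2).le)

theorem exists_root_lt_one (hb : IsRateSequence b) (hd : 0 < genBiDerivOne b i) :
    ∃ s ∈ Ico (0 : ℝ) 1, genBi b i s = 0 := by
  have hev := (tendsto_slope_genBi hb i).eventually (lt_mem_nhds hd)
  obtain ⟨s, hs, hs01⟩ := (hev.and (Ioo_mem_nhdsLT zero_lt_one)).exists
  rw [hb.slope_genBi] at hs
  have hs : 0 < genBi b i s / (s - 1) := by exact_mod_cast hs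
  have hneg : genBi b i s < 0 := by
    by_contra! hpos
    exact hs.not_ge (div_nonpos_of_nonneg_of_nonpos hpos (sub_neg.2 hs01.2).le)
  have h0 : 0 ≤ genBi b i 0 := by
    rw [genBi_zero]
    exact mul_nonneg (Nat.cast_nonneg _) hb.zero_pos.le
  obtain ⟨r, hr, hr0⟩ := intermediate_value_Icc' hs01.1.le
    ((hb.continuousOn_genBi i).mono (Icc_subset_Icc_right hs01.2.le)) ⟨hneg.le, h0⟩
  exact ⟨r, ⟨hr.1, hr.2.trans_lt hs01.2⟩, hr0⟩

theorem exists_isLeast_root (hb : IsRateSequence b) (i : ℕ) :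
    ∃ u, IsLeast {s | s ∈ Icc (0 : ℝ) 1 ∧ genBi b i s = 0} u := by
  have hclosed : IsClosed (Icc (0 : ℝ) 1 ∩ genBi b i ⁻¹' {0}) :=
    (hb.continuousOn_genBi i).preimage_isClosed_of_isClosed isClosed_Icc isClosed_singleton
  exact (isCompact_Icc.of_isClosed_subset hclosed inter_subset_left).exists_isLeast
    ⟨1, right_mem_Icc.2 zero_le_one, hb.genBi_one i⟩

theorem eq_one_of_isLeast_root (hb : IsRateSequence b) (hd : genBiDerivOne b i ≤ 0)
    (hu : IsLeast {s | s ∈ Icc (0 : ℝ) 1 ∧ genBi b i s = 0} u) : u = 1 := by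
  by_contra hne
  exact (genBi_pos hb hd ⟨hu.1.1.1, hu.1.1.2.lt_of_ne hne⟩).ne' hu.1.2

theorem lt_one_of_isLeast_root (hb : IsRateSequence b) (hd : 0 < genBiDerivOne b i)
    (hu : IsLeast {s | s ∈ Icc (0 : ℝ) 1 ∧ genBi b i s = 0} u) : u < 1 := by
  obtain ⟨s, hs, hs0⟩ := exists_root_lt_one hb hd
  exact (hu.2 ⟨Ico_subset_Icc_self hs, hs0⟩).trans_lt hs.2

end Roots

end GeneratingFunctions

/-! ### The generating function of the occupation times -/

theorem hasSum_of_tendsto_tsum_mul_pow {a : ℕ → ℝ} {V : ℝ} (ha : ∀ i, 0 ≤ a i)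
    (hsum : ∀ s ∈ Ico (0 : ℝ) 1, Summable fun i => a i * s ^ i)
    (h : Tendsto (fun s => ∑' i, a i * s ^ i) (𝓝[<] 1) (𝓝 V)) : HasSum a V := by
  have hpartial : ∀ N, ∑ i ∈ Finset.range N, a i ≤ V := fun N => by
    have hcont : Continuous fun s : ℝ => ∑ i ∈ Finset.range N, a i * s ^ i := by fun_prop
    have hlim := (hcont.tendsto 1).mono_left (nhdsWithin_le_nhds (s := Iio 1))
    simp only [one_pow, mul_one] at hlim
    refine le_of_tendsto_of_tendsto hlim h ?_
    filter_upwards [Ioo_mem_nhdsLT zero_lt_one] with s hs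
    exact (hsum s (Ioo_subset_Ico_self hs)).sum_le_tsum _ fun i _ =>
      mul_nonneg (ha i) (pow_nonneg hs.1.le i)
  have hsummable := summable_of_sum_range_le ha hpartial
  rw [tendsto_nhds_unique h
    (Real.tendsto_tsum_powerSeries_nhdsWithin_lt hsummable.hasSum.tendsto_sum_nat)]
  exact hsummable.hasSum

section OccupationTimes

variable {b : ℕ → ℝ} {c k : ℕ} {p : ℝ → ℕ → ℕ → ℝ} {s t : ℝ} {m : ℕ → ℝ}

theorem OccupationRecursion.tendsto_neg_slope_mul_tsum (h : OccupationRecursion b c k 1 m)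
    (hb : IsRateSequence b) (hc : 1 ≤ c) (hk : 1 ≤ k)
    (hm : ∀ s ∈ Ico (0 : ℝ) 1, Summable fun i => m (i + 1) * s ^ i) :
    Tendsto (fun s => -slope (genBi b c) 1 s * ∑' i, m (i + 1) * s ^ i) (𝓝[<] 1)
      (𝓝 ((k : ℝ) + ∑ i ∈ Finset.Icc 1 (c - 1), m i * ((c : ℝ) - (i : ℝ)) * b 0)) := by
  have hcont : Continuous fun s : ℝ => ∑ l ∈ Finset.range k, s ^ l +
      ∑ i ∈ Finset.Icc 1 (c - 1), m i * s ^ (i - 1) * ((c : ℝ) - i) * b 0 := by fun_prop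
  have hlim := (hcont.tendsto 1).mono_left (nhdsWithin_le_nhds (s := Iio 1))
  simp only [one_pow, mul_one, Finset.sum_const, Finset.card_range, nsmul_eq_mul] at hlim
  refine hlim.congr' ?_
  filter_upwards [Ioo_mem_nhdsLT zero_lt_one] with s hs
  have hne : s - 1 ≠ 0 := (sub_neg.2 hs.2).ne
  have hgf := h.genBi_mul_tsum hb hc hk (Ioo_subset_Icc_self hs) (hm s (Ioo_subset_Ico_self hs))
  rw [occupationNumerator, ← neg_sub (s ^ k), ← geom_sum_mul] at hgf
  rw [hb.slope_genBi, ← div_neg, div_mul_eq_mul_div, hgf, eq_div_iff (neg_ne_zero.2 hne),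
    ← Finset.sum_mul]
  ring

namespace IsQFunction

theorem tendsto_pgf (hp : IsQFunction (qStar b c) p) (hb : IsRateSequence b) (hc : 1 ≤ c)
    (hk : 1 ≤ k) (hs : s ∈ Ico (0 : ℝ) 1) :
    Tendsto (fun t => ∑' j, p t k j * s ^ j) atTop (𝓝 (b 0 * occupationTime p k 1)) := by
  rw [← tsum_ite_eq 0 fun _ : ℕ => b 0 * occupationTime p k 1]
  refine tendsto_tsum_of_dominated_convergence (summable_geometric_of_lt_one hs.1 hs.2)
    (fun j => ?_) ?_
  · rcases Nat.eq_zero_or_pos j with rfl | hj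
    · simpa using hp.tendsto_absorbed hb hc hk
    · have h := (hp.tendsto_transition hb hc k j).mul_const (s ^ j)
      rw [hp.vecMulQStar_occupationTime hb hc k hj, neg_add_cancel, zero_mul] at h
      rwa [if_neg hj.ne']
  · filter_upwards [eventually_ge_atTop 0] with t ht j
    have hsj := pow_nonneg hs.1 j
    rw [norm_mul, Real.norm_of_nonneg (hp.nonneg t ht k j), Real.norm_of_nonneg hsj]
    exact mul_le_of_le_one_left hsj (hp.le_one ht k j)

theorem genBi_mul_tsum_upTo (hp : IsQFunction (qStar b c) p) (hb : IsRateSequence b) (hc : 1 ≤ c)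
    (k : ℕ) (hs : s ∈ Ico (0 : ℝ) 1) (ht : 0 ≤ t) :
    (Summable fun i => occupationTimeUpTo p k (i + 1) t * s ^ i) ∧
    genBi b c s * ∑' i, occupationTimeUpTo p k (i + 1) t * s ^ i =
      occupationNumerator b c k (∑' j, p t k j * s ^ j)
        (fun i => occupationTimeUpTo p k i t) s := by
  have hgeom := summable_geometric_of_lt_one hs.1 hs.2
  have hocc : Summable fun i => occupationTimeUpTo p k (i + 1) t * s ^ i :=
    (hgeom.mul_left t).of_nonneg_of_le
      (fun i => mul_nonneg (hp.occupationTimeUpTo_nonneg k _ ht) (pow_nonneg hs.1 i))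
      fun i => mul_le_mul_of_nonneg_right
        (hp.occupationTimeUpTo_le (neg_le_qStar_diag hb hc) k _ ht) (pow_nonneg hs.1 i)
  have hpgf : Summable fun j => p t k j * s ^ j :=
    hgeom.of_nonneg_of_le (fun j => mul_nonneg (hp.nonneg t ht k j) (pow_nonneg hs.1 j))
      fun j => mul_le_of_le_one_left (pow_nonneg hs.1 j) (hp.le_one ht k j)
  exact ⟨hocc, genBi_mul_tsum_of_vecMulQStar_eq hb
    (fun j => hp.vecMulQStar_occupationTimeUpTo hb hc k j ht) (Ico_subset_Icc_self hs) hocc.norm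
    hpgf.hasSum⟩

theorem tendsto_occupationNumerator (hp : IsQFunction (qStar b c) p) (hb : IsRateSequence b)
    (hc : 1 ≤ c) (hk : 1 ≤ k) (hs : s ∈ Ico (0 : ℝ) 1) :
    Tendsto (fun t => genBi b c s * ∑' i, occupationTimeUpTo p k (i + 1) t * s ^ i) atTop
      (𝓝 (occupationNumerator b c k (b 0 * occupationTime p k 1) (occupationTime p k) s)) := by
  have h : Tendsto (fun t => occupationNumerator b c k (∑' j, p t k j * s ^ j)
      (fun i => occupationTimeUpTo p k i t) s) atTop
      (𝓝 (occupationNumerator b c k (b 0 * occupationTime p k 1) (occupationTime p k) s)) := by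
    refine ((hp.tendsto_pgf hb hc hk hs).sub_const _).add (Tendsto.const_mul _ ?_)
    refine tendsto_finsetSum _ fun i hi => ?_
    exact ((hp.tendsto_occupationTimeUpTo hb hc k (Finset.mem_Icc.1 hi).1).mul_const _).mul_const _
  refine h.congr' ?_
  filter_upwards [eventually_ge_atTop 0] with t ht using
    (hp.genBi_mul_tsum_upTo hb hc k hs ht).2.symm

theorem occupationNumerator_eq_zero (hp : IsQFunction (qStar b c) p) (hb : IsRateSequence b)
    (hc : 1 ≤ c) (hk : 1 ≤ k) (hs : s ∈ Ico (0 : ℝ) 1) (hroot : genBi b c s = 0) :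
    occupationNumerator b c k (b 0 * occupationTime p k 1) (occupationTime p k) s = 0 := by
  have h := hp.tendsto_occupationNumerator hb hc hk hs
  simp only [hroot, zero_mul] at h
  exact tendsto_nhds_unique h tendsto_const_nhds

theorem genBi_mul_sum_le (hp : IsQFunction (qStar b c) p) (hb : IsRateSequence b) (hc : 1 ≤ c)
    (hk : 1 ≤ k) (hs : s ∈ Ico (0 : ℝ) 1) (hB : 0 ≤ genBi b c s) (N : ℕ) :
    genBi b c s * ∑ i ∈ Finset.range N, occupationTime p k (i + 1) * s ^ i ≤
      occupationNumerator b c k (b 0 * occupationTime p k 1) (occupationTime p k) s := by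
  have hlim : Tendsto (fun t => genBi b c s *
      ∑ i ∈ Finset.range N, occupationTimeUpTo p k (i + 1) t * s ^ i) atTop
      (𝓝 (genBi b c s * ∑ i ∈ Finset.range N, occupationTime p k (i + 1) * s ^ i)) :=
    (tendsto_finsetSum _ fun i _ =>
      (hp.tendsto_occupationTimeUpTo hb hc k (Nat.le_add_left 1 i)).mul_const _).const_mul _
  refine le_of_tendsto_of_tendsto hlim (hp.tendsto_occupationNumerator hb hc hk hs) ?_
  filter_upwards [eventually_ge_atTop 0] with t ht
  refine mul_le_mul_of_nonneg_left ?_ hB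
  exact (hp.genBi_mul_tsum_upTo hb hc k hs ht).1.sum_le_tsum _ fun i _ =>
    mul_nonneg (hp.occupationTimeUpTo_nonneg k _ ht) (pow_nonneg hs.1 i)

theorem summable_occupationTime_mul_pow (hp : IsQFunction (qStar b c) p) (hb : IsRateSequence b)
    (hc : 1 ≤ c) (hk : 1 ≤ k) (hs : s ∈ Ico (0 : ℝ) 1) (hB : 0 < genBi b c s) :
    Summable fun i => occupationTime p k (i + 1) * s ^ i :=
  summable_of_sum_range_le
    (fun i => mul_nonneg (hp.occupationTime_nonneg k _) (pow_nonneg hs.1 i))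
    fun N => (le_div_iff₀' hB).2 (hp.genBi_mul_sum_le hb hc hk hs hB.le N)

theorem absorbed_eq_one (hp : IsQFunction (qStar b c) p) (hb : IsRateSequence b) (hc : 1 ≤ c)
    (hk : 1 ≤ k) (hd : genBiDerivOne b c ≤ 0) : b 0 * occupationTime p k 1 = 1 := by
  refine (hp.absorbed_le_one hb hc hk).antisymm ?_
  have hlim := ((continuous_occupationNumerator (b := b) (c := c) k (b 0 * occupationTime p k 1)
    (occupationTime p k)).tendsto 1).mono_left (nhdsWithin_le_nhds (s := Iio 1))
  have hnonneg := ge_of_tendsto (b := (0 : ℝ)) hlim <| by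
    filter_upwards [Ioo_mem_nhdsLT zero_lt_one] with s hs
    have hs' := Ioo_subset_Ico_self hs
    simpa using hp.genBi_mul_sum_le hb hc hk hs' (genBi_pos hb hd hs').le 0
  simpa [occupationNumerator] using hnonneg

theorem extinctionSystem (hp : IsQFunction (qStar b c) p) (hb : IsRateSequence b) (hc : 1 ≤ c)
    (hk : 1 ≤ k) {u : ℝ} (hu : IsLeast {s | s ∈ Icc (0 : ℝ) 1 ∧ genBi b c s = 0} u) :
    ExtinctionSystem b c k u (b 0 * occupationTime p k 1) (occupationTime p k) := by
  refine (hp.occupationRecursion hb hc k).extinctionSystem ?_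
  have hzero : occupationNumerator b c k (b 0 * occupationTime p k 1) (occupationTime p k) u =
      0 := by
    rcases le_or_gt (genBiDerivOne b c) 0 with hd | hd
    · simp [occupationNumerator, hp.absorbed_eq_one hb hc hk hd, eq_one_of_isLeast_root hb hd hu]
    · exact hp.occupationNumerator_eq_zero hb hc hk
        ⟨hu.1.1.1, lt_one_of_isLeast_root hb hd hu⟩ hu.1.2
  rw [occupationNumerator] at hzero
  rw [← Finset.sum_mul, ← Finset.sum_mul]
  linear_combination hzero

theorem sum_idle_nonneg (hp : IsQFunction (qStar b c) p) (hb : IsRateSequence b) (k : ℕ)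
    (hs : 0 ≤ s) :
    0 ≤ ∑ i ∈ Finset.Icc 1 (c - 1), occupationTime p k i * s ^ (i - 1) * ((c : ℝ) - i) * b 0 := by
  refine Finset.sum_nonneg fun i hi => ?_
  have hic : 0 ≤ (c : ℝ) - i := sub_nonneg.2 (Nat.cast_le.2 (by grind))
  have := hb.zero_pos
  have := hp.occupationTime_nonneg k i
  positivity

theorem absorbed_lt_one (hp : IsQFunction (qStar b c) p) (hb : IsRateSequence b) (hc : 1 ≤ c)
    (hk : 1 ≤ k) (hd : 0 < genBiDerivOne b c) : b 0 * occupationTime p k 1 < 1 := by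
  obtain ⟨u, hu⟩ := exists_isLeast_root hb c
  have hu1 := lt_one_of_isLeast_root hb hd hu
  rw [(hp.extinctionSystem hb hc hk hu).root, ← Finset.sum_mul]
  have hidle := mul_nonneg (hp.sum_idle_nonneg (c := c) hb k hu.1.1.1) (sub_nonneg.2 hu1.le)
  have hpow : u ^ k < 1 := pow_lt_one₀ hu.1.1.1 hu1 (by omega)
  linarith

theorem hasSum_occupationTime (hp : IsQFunction (qStar b c) p) (hb : IsRateSequence b)
    (hc : 1 ≤ c) (hk : 1 ≤ k) (hd : genBiDerivOne b c < 0) :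
    HasSum (fun i => occupationTime p k (i + 1)) (-(1 / (genBiDerivOne b c).toReal) *
      ((k : ℝ) + ∑ i ∈ Finset.Icc 1 (c - 1),
        occupationTime p k i * ((c : ℝ) - (i : ℝ)) * b 0)) := by
  have hsum : ∀ s ∈ Ico (0 : ℝ) 1, Summable fun i => occupationTime p k (i + 1) * s ^ i :=
    fun s hs => hp.summable_occupationTime_mul_pow hb hc hk hs (genBi_pos hb hd.le hs)
  have hD : (genBiDerivOne b c).toReal < 0 := by
    have h := EReal.coe_toReal (hd.trans EReal.zero_lt_top).ne (genBiDerivOne_ne_bot c)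
    exact_mod_cast h ▸ hd
  have hslope := tendsto_slope_genBi_toReal hb (hd.trans EReal.zero_lt_top).ne
  have hrec := hp.occupationRecursion hb hc k
  rw [hp.absorbed_eq_one hb hc hk hd.le] at hrec
  refine hasSum_of_tendsto_tsum_mul_pow (fun i => hp.occupationTime_nonneg k _) hsum ?_
  have h := (hslope.neg.inv₀ (neg_ne_zero.2 hD.ne)).mul
    (hrec.tendsto_neg_slope_mul_tsum hb hc hk hsum)
  rw [inv_neg, ← one_div] at h
  refine h.congr' ?_
  filter_upwards [hslope.eventually (gt_mem_nhds hD)] with s hs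
  rw [inv_mul_cancel_left₀ (neg_ne_zero.2 hs.ne)]

theorem not_summable_occupationTime (hp : IsQFunction (qStar b c) p) (hb : IsRateSequence b)
    (hc : 1 ≤ c) (hk : 1 ≤ k) (hd : genBiDerivOne b c = 0) :
    ¬ Summable fun i => occupationTime p k (i + 1) := fun hsummable => by
  have hslope := tendsto_slope_genBi_toReal hb (hd.trans_ne EReal.zero_ne_top)
  rw [hd, EReal.toReal_zero] at hslope
  have hrec := hp.occupationRecursion hb hc k
  rw [hp.absorbed_eq_one hb hc hk hd.le] at hrec
  have hlim := hslope.neg.mul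
    (Real.tendsto_tsum_powerSeries_nhdsWithin_lt hsummable.hasSum.tendsto_sum_nat)
  have heq := tendsto_nhds_unique hlim <| hrec.tendsto_neg_slope_mul_tsum hb hc hk fun s hs =>
    hp.summable_occupationTime_mul_pow hb hc hk hs (genBi_pos hb hd.le hs)
  have hidle := hp.sum_idle_nonneg (c := c) hb k zero_le_one
  simp only [one_pow, mul_one] at hidle
  have hk' : (1 : ℝ) ≤ k := Nat.one_le_cast.2 hk
  linarith

end IsQFunction

end OccupationTimes

/-! ### The extinction time of the Markov chain -/

section Paths

variable {Ω : Type*} {X : ℝ≥0 → Ω → ℕ} {ω : Ω} {t : ℝ≥0}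

/-- A right-continuous path on `ℕ` that never leaves the state `0`. -/
structure IsAbsorbedPath (x : ℝ≥0 → ℕ) : Prop where
  rightCts : ∀ t, ContinuousWithinAt x (Ici t) t
  absorbed : ∀ s t, s ≤ t → x s = 0 → x t = 0

theorem exists_Ico_forall_eq {x : ℝ≥0 → ℕ} (h : ContinuousWithinAt x (Ici t) t) :
    ∃ u, t < u ∧ ∀ r ∈ Ico t u, x r = x t := by
  have heq : ∀ᶠ r in 𝓝[≥] t, x r = x t := by
    simpa [ContinuousWithinAt] using h
  obtain ⟨u, htu, hu⟩ := (mem_nhdsGE_iff_exists_Ico_subset' (lt_add_one t)).1 heq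
  exact ⟨u, htu, fun r hr => hu hr⟩

theorem extinctionTime_le (ht : 0 < t) (h : X t ω = 0) : extinctionTime X ω ≤ t :=
  iInf₂_le t ⟨ht, h⟩

theorem extinctionTime_lt_iff {a : ℝ≥0∞} :
    extinctionTime X ω < a ↔ ∃ t : ℝ≥0, (0 < t ∧ X t ω = 0) ∧ (t : ℝ≥0∞) < a := by
  simp only [extinctionTime, iInf_lt_iff, exists_prop]

namespace IsAbsorbedPath

theorem lt_extinctionTime (hω : IsAbsorbedPath (X · ω)) (h : X t ω ≠ 0) :
    t < extinctionTime X ω := by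
  obtain ⟨u, htu, hu⟩ := exists_Ico_forall_eq (hω.rightCts t)
  refine (ENNReal.coe_lt_coe.2 htu).trans_le (le_iInf₂ fun r hr => ENNReal.coe_le_coe.2 ?_)
  have htr : t ≤ r := le_of_not_gt fun hrt => h (hω.absorbed r t hrt.le hr.2)
  by_contra! hru
  exact h ((hu r ⟨htr, hru⟩).symm.trans hr.2)

theorem extinctionTime_le_iff (hω : IsAbsorbedPath (X · ω)) (ht : 0 < t) :
    extinctionTime X ω ≤ t ↔ X t ω = 0 :=
  ⟨fun h => by_contra fun h0 => (hω.lt_extinctionTime h0).not_ge h, extinctionTime_le ht⟩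

theorem extinctionTime_eq_iInf_denseSeq (hω : IsAbsorbedPath (X · ω)) :
    extinctionTime X ω = ⨅ n : ℕ, if 0 < TopologicalSpace.denseSeq ℝ≥0 n ∧
      X (TopologicalSpace.denseSeq ℝ≥0 n) ω = 0 then
        (TopologicalSpace.denseSeq ℝ≥0 n : ℝ≥0∞) else ∞ := by
  refine le_antisymm (le_iInf fun n => ?_) (le_of_not_gt fun hlt => ?_)
  · split_ifs with h
    exacts [extinctionTime_le h.1 h.2, le_top]
  · obtain ⟨s, hs, hlt⟩ := extinctionTime_lt_iff.1 hlt
    obtain ⟨t, hst, ht⟩ := ENNReal.lt_iff_exists_nnreal_btwn.1 hlt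
    obtain ⟨n, hn⟩ := (TopologicalSpace.denseRange_denseSeq ℝ≥0).exists_mem_open
      isOpen_Ioo (nonempty_Ioo.2 (ENNReal.coe_lt_coe.1 hst))
    refine absurd (ht.trans_le (iInf_le _ n)) (not_lt.2 ?_)
    rw [if_pos ⟨hs.1.trans hn.1, hω.absorbed _ _ hn.1.le hs.2⟩]
    exact ENNReal.coe_le_coe.2 hn.2.le

end IsAbsorbedPath

variable [MeasurableSpace Ω] {μ : Measure Ω}

theorem aemeasurable_extinctionTime (hX : ∀ t, Measurable (X t))
    (habs : ∀ᵐ ω ∂μ, IsAbsorbedPath (X · ω)) : AEMeasurable (extinctionTime X) μ := by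
  refine ⟨fun ω => ⨅ n : ℕ, if 0 < TopologicalSpace.denseSeq ℝ≥0 n ∧
      X (TopologicalSpace.denseSeq ℝ≥0 n) ω = 0 then
        (TopologicalSpace.denseSeq ℝ≥0 n : ℝ≥0∞) else ∞, ?_, ?_⟩
  · refine Measurable.iInf fun n => Measurable.ite ?_ measurable_const measurable_const
    exact (MeasurableSet.const _).inter (hX _ (measurableSet_singleton 0))
  · filter_upwards [habs] with ω hω using hω.extinctionTime_eq_iInf_denseSeq

theorem tendsto_measure_eq_zero (habs : ∀ᵐ ω ∂μ, IsAbsorbedPath (X · ω)) :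
    Tendsto (fun n : ℕ => μ {ω | X n ω = 0}) atTop (𝓝 (μ {ω | extinctionTime X ω < ∞})) := by
  have hunion : {ω | extinctionTime X ω < ∞} = ⋃ n : ℕ, {ω | extinctionTime X ω ≤ n} := by
    ext ω
    simp only [mem_ofPred_eq, mem_iUnion]
    exact ⟨fun h => (ENNReal.exists_nat_gt h.ne).imp fun _ => le_of_lt,
      fun ⟨n, hn⟩ => hn.trans_lt (ENNReal.natCast_lt_top n)⟩
  rw [hunion]
  refine (tendsto_measure_iUnion_atTop fun (n m : ℕ) hnm ω (hω : extinctionTime X ω ≤ n) =>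
    hω.trans (Nat.cast_le.2 hnm)).congr' ?_
  filter_upwards [eventually_gt_atTop 0] with n hn
  refine measure_congr ?_
  filter_upwards [habs] with ω hω
  exact propext (hω.extinctionTime_le_iff (t := n) (Nat.cast_pos.2 hn))

theorem volume_restrict_Ioi_ofReal_lt (a : ℝ≥0∞) :
    volume.restrict (Ioi 0) {t : ℝ | ENNReal.ofReal t < a} = a := by
  have hmeas : MeasurableSet {t : ℝ | ENNReal.ofReal t < a} :=
    measurableSet_lt ENNReal.measurable_ofReal measurable_const
  rw [Measure.restrict_apply hmeas]
  induction a with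
  | top => simp
  | coe a =>
    have hIoo : {t : ℝ | ENNReal.ofReal t < a} ∩ Ioi 0 = Ioo 0 (a : ℝ) := by
      ext t
      rw [mem_inter_iff, and_comm, mem_Ioi, mem_Ioo, mem_ofPred_eq]
      refine and_congr_right fun ht => ?_
      rw [ENNReal.ofReal_lt_coe_iff ht.le]
    simp [hIoo]

theorem lintegral_eq_lintegral_Ioi_measure_lt [SFinite μ] {f : Ω → ℝ≥0∞} (hf : AEMeasurable f μ) :
    ∫⁻ ω, f ω ∂μ = ∫⁻ t in Ioi (0 : ℝ), μ {ω | ENNReal.ofReal t < f ω} := by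
  obtain ⟨g, hg, hfg⟩ := hf
  have hmeas : MeasurableSet {x : Ω × ℝ | ENNReal.ofReal x.2 < g x.1} :=
    measurableSet_lt (by fun_prop) (by fun_prop)
  calc ∫⁻ ω, f ω ∂μ = ∫⁻ ω, g ω ∂μ := lintegral_congr_ae hfg
    _ = (μ.prod (volume.restrict (Ioi 0))) {x | ENNReal.ofReal x.2 < g x.1} := by
      rw [Measure.prod_apply hmeas]
      exact lintegral_congr fun ω => (volume_restrict_Ioi_ofReal_lt (g ω)).symm
    _ = ∫⁻ t in Ioi (0 : ℝ), μ {ω | ENNReal.ofReal t < g ω} := Measure.prod_apply_symm hmeas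
    _ = ∫⁻ t in Ioi (0 : ℝ), μ {ω | ENNReal.ofReal t < f ω} := by
      refine lintegral_congr fun t => measure_congr ?_
      filter_upwards [hfg] with ω hω
      exact congrArg (ENNReal.ofReal t < ·) hω.symm

theorem lintegral_extinctionTime [SFinite μ] (hX : ∀ t, Measurable (X t))
    (habs : ∀ᵐ ω ∂μ, IsAbsorbedPath (X · ω)) :
    ∫⁻ ω, extinctionTime X ω ∂μ = ∫⁻ t in Ioi (0 : ℝ), μ {ω | X t.toNNReal ω ≠ 0} := by
  rw [lintegral_eq_lintegral_Ioi_measure_lt (aemeasurable_extinctionTime hX habs)]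
  refine setLIntegral_congr_fun measurableSet_Ioi fun t ht => measure_congr ?_
  filter_upwards [habs] with ω hω
  exact propext ((not_congr (hω.extinctionTime_le_iff (Real.toNNReal_pos.2 ht))).symm.trans
    not_le).symm

end Paths

namespace IsMarkovChain

variable {b : ℕ → ℝ} {c : ℕ} {p : ℝ → ℕ → ℕ → ℝ}
  {Ω : Type*} [MeasurableSpace Ω] {P : Measure Ω} {X : ℝ≥0 → Ω → ℕ} {k : ℕ}

theorem measurableSet_eq (hX : IsMarkovChain p X P) (t : ℝ≥0) (j : ℕ) :
    MeasurableSet {ω | X t ω = j} :=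
  hX.measurable t (measurableSet_singleton j)

theorem cond_eq [IsFiniteMeasure P] (hX : IsMarkovChain p X P) (hPk : P {ω | X 0 ω = k} ≠ 0)
    (t : ℝ≥0) (j : ℕ) :
    P[|{ω | X 0 ω = k}] {ω | X t ω = j} = ENNReal.ofReal (p t k j) := by
  have hlaw := hX.law 1 (fun l => if l = 0 then 0 else t)
    (monotone_nat_of_le_succ fun l => by rcases l with _ | l <;> simp) rfl
    (fun l => if l = 0 then k else j)
  have hset : {ω | ∀ l ≤ 1, X (if l = 0 then 0 else t) ω = if l = 0 then k else j} =
      {ω | X 0 ω = k} ∩ {ω | X t ω = j} := by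
    ext ω
    simp [Nat.le_one_iff_eq_zero_or_eq_one]
  rw [cond_apply (hX.measurableSet_eq 0 k), ← hset, hlaw]
  simp [← mul_assoc, ENNReal.inv_mul_cancel hPk (measure_ne_top _ _)]

theorem cond_ne_zero [IsFiniteMeasure P] (hX : IsMarkovChain p X P)
    (hPk : P {ω | X 0 ω = k} ≠ 0) (t : ℝ≥0) :
    P[|{ω | X 0 ω = k}] {ω | X t ω ≠ 0} = ∑' i, ENNReal.ofReal (p t k (i + 1)) := by
  have hunion : {ω | X t ω ≠ 0} = ⋃ i : ℕ, {ω | X t ω = i + 1} := by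
    ext ω
    simp [Nat.pos_iff_ne_zero]
  rw [hunion, measure_iUnion (fun i j hij => Set.disjoint_left.2 fun ω hi hj =>
    hij (Nat.succ_injective (hi.symm.trans hj))) fun i => hX.measurableSet_eq t (i + 1)]
  exact tsum_congr fun i => hX.cond_eq hPk t (i + 1)

theorem ae_eq_zero_of_le (hX : IsMarkovChain p X P)
    (h0 : ∀ t, 0 ≤ t → ∀ j, j ≠ 0 → p t 0 j = 0) {s t : ℝ≥0} (hst : s ≤ t) :
    ∀ᵐ ω ∂P, X s ω = 0 → X t ω = 0 := by
  have hnull : ∀ x j : ℕ, ∀ᵐ ω ∂P, ¬ (j ≠ 0 ∧ X 0 ω = x ∧ X s ω = 0 ∧ X t ω = j) := by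
    intro x j
    by_cases hj : j = 0
    · simp [hj]
    have hlaw := hX.law 2 (fun l => if l = 0 then 0 else if l = 1 then s else t)
      (monotone_nat_of_le_succ fun l => by rcases l with _ | _ | l <;> simp [hst]) rfl
      (fun l => if l = 0 then x else if l = 1 then 0 else j)
    rw [Finset.prod_range_succ] at hlaw
    simp only [one_ne_zero, OfNat.ofNat_ne_zero, Nat.reduceAdd, OfNat.ofNat_ne_one, if_false,
      if_true, h0 ((t : ℝ) - s) (sub_nonneg.2 (NNReal.coe_le_coe.2 hst)) j hj, ENNReal.ofReal_zero,
      mul_zero] at hlaw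
    refine measure_mono_null (fun ω hω => ?_) hlaw
    simp only [mem_compl_iff, mem_ofPred_eq, not_not] at hω
    intro l hl
    interval_cases l
    exacts [hω.2.1, hω.2.2.1, hω.2.2.2]
  filter_upwards [ae_all_iff.2 fun x => ae_all_iff.2 (hnull x)] with ω hω hs
  by_contra ht
  exact hω (X 0 ω) (X t ω) ⟨ht, rfl, hs, rfl⟩

theorem ae_isAbsorbedPath (hX : IsMarkovChain p X P)
    (h0 : ∀ t, 0 ≤ t → ∀ j, j ≠ 0 → p t 0 j = 0) : ∀ᵐ ω ∂P, IsAbsorbedPath (X · ω) := by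
  set d := TopologicalSpace.denseSeq ℝ≥0
  have hd : ∀ n m, ∀ᵐ ω ∂P, d n ≤ d m → X (d n) ω = 0 → X (d m) ω = 0 := fun n m => by
    by_cases h : d n ≤ d m
    · filter_upwards [hX.ae_eq_zero_of_le h0 h] with ω hω _ using hω
    · exact Eventually.of_forall fun ω h' => absurd h' h
  filter_upwards [hX.rightCts, ae_all_iff.2 fun n => ae_all_iff.2 (hd n)] with ω hr hω
  refine ⟨hr, fun s t hst hs => ?_⟩
  rcases hst.eq_or_lt with rfl | hlt
  · exact hs
  have hdense : ∀ r r' : ℝ≥0, r < r' → ∃ n, d n ∈ Ioo r r' ∧ X (d n) ω = X r ω := by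
    intro r r' hrr'
    obtain ⟨u, hru, hu⟩ := exists_Ico_forall_eq (hr r)
    obtain ⟨n, hn⟩ := (TopologicalSpace.denseRange_denseSeq ℝ≥0).exists_mem_open
      isOpen_Ioo (nonempty_Ioo.2 (lt_min hru hrr'))
    exact ⟨n, ⟨hn.1, hn.2.trans_le (min_le_right _ _)⟩,
      hu _ ⟨hn.1.le, hn.2.trans_le (min_le_left _ _)⟩⟩
  obtain ⟨n, hn, hsn⟩ := hdense s t hlt
  obtain ⟨m, hm, htm⟩ := hdense t (t + 1) (lt_add_one t)
  rw [← htm]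
  exact hω n m (hn.2.trans hm.1).le (hsn.trans hs)

theorem ae_cond_isAbsorbedPath (hX : IsMarkovChain p X P) (hp : IsQFunction (qStar b c) p) (k : ℕ) :
    ∀ᵐ ω ∂(P[|{ω | X 0 ω = k}]), IsAbsorbedPath (X · ω) :=
  cond_absolutelyContinuous.ae_le <| hX.ae_isAbsorbedPath fun _ ht _ hj =>
    hp.eq_zero_of_diag_eq_zero ht (qStar_zero_left 0) hj.symm

variable [IsFiniteMeasure P]

theorem cond_extinctionTime_lt_top (hX : IsMarkovChain p X P) (hp : IsQFunction (qStar b c) p)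
    (hb : IsRateSequence b) (hc : 1 ≤ c) (hk : 1 ≤ k) (hPk : P {ω | X 0 ω = k} ≠ 0) :
    P[|{ω | X 0 ω = k}] {ω | extinctionTime X ω < ∞} =
      ENNReal.ofReal (b 0 * occupationTime p k 1) := by
  refine tendsto_nhds_unique (tendsto_measure_eq_zero (hX.ae_cond_isAbsorbedPath hp k)) ?_
  refine (ENNReal.tendsto_ofReal
    ((hp.tendsto_absorbed hb hc hk).comp tendsto_natCast_atTop_atTop)).congr fun n => ?_
  rw [hX.cond_eq hPk]
  simp

theorem extinctionProb_eq (hX : IsMarkovChain p X P) (hp : IsQFunction (qStar b c) p)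
    (hb : IsRateSequence b) (hc : 1 ≤ c) (hk : 1 ≤ k) (hPk : P {ω | X 0 ω = k} ≠ 0) :
    extinctionProb X P k = b 0 * occupationTime p k 1 := by
  rw [extinctionProb, hX.cond_extinctionTime_lt_top hp hb hc hk hPk,
    ENNReal.toReal_ofReal (mul_nonneg hb.zero_pos.le (hp.occupationTime_nonneg k 1))]

theorem meanExtinctionTime_eq_tsum (hX : IsMarkovChain p X P) (hp : IsQFunction (qStar b c) p)
    (hb : IsRateSequence b) (hc : 1 ≤ c) (hPk : P {ω | X 0 ω = k} ≠ 0) :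
    meanExtinctionTime X P k = ∑' i, ENNReal.ofReal (occupationTime p k (i + 1)) := by
  have hint (i : ℕ) : IntegrableOn (fun t => p t k (i + 1)) (Ioi 0) :=
    hp.integrableOn hb hc k (Nat.le_add_left 1 i)
  calc meanExtinctionTime X P k
      = ∫⁻ t in Ioi (0 : ℝ), P[|{ω | X 0 ω = k}] {ω | X t.toNNReal ω ≠ 0} :=
        lintegral_extinctionTime hX.measurable (hX.ae_cond_isAbsorbedPath hp k)
    _ = ∫⁻ t in Ioi (0 : ℝ), ∑' i, ENNReal.ofReal (p t k (i + 1)) :=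
        setLIntegral_congr_fun measurableSet_Ioi fun t ht => by
          simp only [hX.cond_ne_zero hPk, Real.coe_toNNReal t (le_of_lt ht)]
    _ = ∑' i, ∫⁻ t in Ioi (0 : ℝ), ENNReal.ofReal (p t k (i + 1)) :=
        lintegral_tsum fun i => (hint i).aemeasurable.ennreal_ofReal
    _ = ∑' i, ENNReal.ofReal (occupationTime p k (i + 1)) := tsum_congr fun i =>
        (ofReal_integral_eq_lintegral_ofReal (hint i) <| by
          filter_upwards [ae_restrict_mem measurableSet_Ioi] with t ht
          exact hp.nonneg t (le_of_lt ht) k _).symm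

theorem meanExtinctionTime_of_neg (hX : IsMarkovChain p X P) (hp : IsQFunction (qStar b c) p)
    (hb : IsRateSequence b) (hc : 1 ≤ c) (hk : 1 ≤ k) (hPk : P {ω | X 0 ω = k} ≠ 0)
    (hd : genBiDerivOne b c < 0) :
    meanExtinctionTime X P k =
      ENNReal.ofReal (-(1 / (genBiDerivOne b c).toReal) *
        ((k : ℝ) + ∑ i ∈ Finset.Icc 1 (c - 1),
          occupationTime p k i * ((c : ℝ) - (i : ℝ)) * b 0)) := by
  have hsum := hp.hasSum_occupationTime hb hc hk hd
  rw [hX.meanExtinctionTime_eq_tsum hp hb hc hPk, ← hsum.tsum_eq,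
    ENNReal.ofReal_tsum_of_nonneg (fun i => hp.occupationTime_nonneg k _) hsum.summable]

theorem meanExtinctionTime_eq_top (hX : IsMarkovChain p X P) (hp : IsQFunction (qStar b c) p)
    (hb : IsRateSequence b) (hc : 1 ≤ c) (hk : 1 ≤ k) (hPk : P {ω | X 0 ω = k} ≠ 0)
    (hd : 0 ≤ genBiDerivOne b c) : meanExtinctionTime X P k = ∞ := by
  by_contra hfin
  rcases hd.eq_or_lt with hd | hd
  · rw [hX.meanExtinctionTime_eq_tsum hp hb hc hPk] at hfin
    exact hp.not_summable_occupationTime hb hc hk hd.symm <|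
      (ENNReal.summable_toReal hfin).congr fun i =>
        ENNReal.toReal_ofReal (hp.occupationTime_nonneg k _)
  · have := cond_isProbabilityMeasure hPk
    have hmeas := aemeasurable_extinctionTime hX.measurable (hX.ae_cond_isAbsorbedPath hp k)
    have hone : P[|{ω | X 0 ω = k}] {ω | extinctionTime X ω < ∞} = 1 :=
      (mem_ae_iff_prob_eq_one₀ (hmeas.nullMeasurable measurableSet_Iio)).1 (ae_lt_top' hmeas hfin)
    rw [hX.cond_extinctionTime_lt_top hp hb hc hk hPk, ENNReal.ofReal_eq_one] at hone
    exact (hp.absorbed_lt_one hb hc hk hd).ne hone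

end IsMarkovChain

end StoppedQueue

end

open StoppedQueue in
theorem theorem2p3 (c : ℕ) (hc : 1 ≤ c) (b : ℕ → ℝ) (hb : IsRateSequence b)
    (p : ℝ → ℕ → ℕ → ℝ) (hp : IsQFunction (qStar b c) p)
    {Ω : Type*} [MeasurableSpace Ω] (P : Measure Ω) [IsProbabilityMeasure P]
    (X : ℝ≥0 → Ω → ℕ) (hX : IsMarkovChain p X P)
    (k : ℕ) (hk : 1 ≤ k) (hPk : P {ω | X 0 ω = k} ≠ 0) :
    -- the two expressions for the extinction probability agree
    Tendsto (fun t => p t k 0) atTop (𝓝 (extinctionProb X P k)) ∧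
    -- the expected occupation times are finite
    (∀ i, 1 ≤ i → IntegrableOn (fun t => p t k i) (Ioi 0)) ∧
    -- (i)
    (genBiDerivOne b c ≤ 0 → extinctionProb X P k = 1) ∧
    -- (ii), whatever the sign of the derivative
    (∃ u : ℝ, IsLeast {s | s ∈ Icc (0 : ℝ) 1 ∧ genBi b c s = 0} u ∧
      (genBiDerivOne b c ≤ 0 → u = 1) ∧ (0 < genBiDerivOne b c → u < 1) ∧
      ExtinctionSystem b c k u (extinctionProb X P k) (occupationTime p k) ∧
      (∀ (e : ℝ) (m : ℕ → ℝ), ExtinctionSystem b c k u e m →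
        e = extinctionProb X P k ∧ ∀ i, 1 ≤ i → i ≤ c - 1 → m i = occupationTime p k i) ∧
      -- all the occupation times are determined
      OccupationRecursion b c k (extinctionProb X P k) (occupationTime p k) ∧
      (∀ m : ℕ → ℝ, OccupationRecursion b c k (extinctionProb X P k) m →
        ∀ i, 1 ≤ i → m i = occupationTime p k i)) ∧
    -- (iii)
    (genBiDerivOne b c < 0 →
      meanExtinctionTime X P k =
        ENNReal.ofReal (-(1 / (genBiDerivOne b c).toReal) *
          ((k : ℝ) + ∑ i ∈ Finset.Icc 1 (c - 1),
            occupationTime p k i * ((c : ℝ) - (i : ℝ)) * b 0))) ∧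
    (0 ≤ genBiDerivOne b c → meanExtinctionTime X P k = ∞) := by
  rw [hX.extinctionProb_eq hp hb hc hk hPk]
  obtain ⟨u, hu⟩ := exists_isLeast_root hb c
  have hsys := hp.extinctionSystem hb hc hk hu
  have hrec := hp.occupationRecursion hb hc k
  exact ⟨hp.tendsto_absorbed hb hc hk, fun i hi => hp.integrableOn hb hc k hi,
    hp.absorbed_eq_one hb hc hk,
    ⟨u, hu, fun hd => eq_one_of_isLeast_root hb hd hu, fun hd => lt_one_of_isLeast_root hb hd hu,
      hsys, fun e m h => h.unique hb hc hu.1.1 hsys, hrec, fun m h => h.unique hb hc hrec⟩,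
    hX.meanExtinctionTime_of_neg hp hb hc hk hPk, hX.meanExtinctionTime_eq_top hp hb hc hk hPk⟩
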